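/- Let $\langle a,b\rangle=-\tfrac12\operatorname{tr}(\operatorname{adj}(a)b)$ on $M(2,\mathbb R)$, and write the tangent vectors of $\mathrm{SL}(2,\mathbb R)\times\mathrm{SL}(2,\mathbb R)$ at $(a,b)$ as $(a\alpha,b\beta)$ with $\alpha,\beta\in\mathfrak{sl}(2,\mathbb R)$. Let $\langle\cdot,\cdot\rangle$ also denote the product metric, and define $$J(a\alpha,b\beta)=\tfrac1{\sqrt3}\bigl(a(\alpha-2\beta),\,b(2\alpha-\beta)\bigr),\qquad P(a\alpha,b\beta)=(a\beta,b\alpha),$$ $$g\bigl((a\alpha,b\beta),(a\gamma,b\delta)\bigr)=\tfrac23\bigl\langle(a\alpha,b\beta),(a\gamma,b\delta)\bigr\rangle-\tfrac13\bigl\langle(a\beta,b\alpha),(a\gamma,b\delta)\bigr\rangle .$$ Let $f:M\to\mathrm{SL}(2,\mathbb R)\times\mathrm{SL}(2,\mathbb R)$ be a smooth Lagrangian immersion of a smooth $3$-manifold $M$: the metric induced on $M$ by $g$ is nondegenerate, and $J$ maps tangent spaces of $M$ into normal spaces and vice versa. Let $A,B$ be the endomorphisms of $TM$ (identified with $df(TM)$)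 with $P|_{TM}=A+JB$. Suppose that $M$ is of diagonalizable type: around every point of $M$ there are an open neighbourhood $U$, a smooth frame $E_1,E_2,E_3$ of $TM$ on $U$ with $g(E_i,E_j)=0$ for $i\ne j$, $g(E_1,E_1)=-1$ and $g(E_2,E_2)=g(E_3,E_3)=1$, and functions $\theta_1,\theta_2,\theta_3:U\to\mathbb R$ (the angle functions) such that $$AE_i=\cos(2\theta_i)E_i,\qquad BE_i=\sin(2\theta_i)E_i\qquad(i=1,2,3).$$ Suppose moreover that the neighbourhoods, frames and angle functions can be chosen so that on each $U$ two of the angle functions are equal modulo $\pi$, that is, $\theta_i-\theta_j\in\pi\mathbb Z$ at every point of $U$ for some $i\neq j$. Then $M$ is totally geodesic: its second fundamental form, the normal part of $\widetilde\nabla_X\,df(Y)$ for vector fields $X,Y$ on $M$, where $\widetilde\nabla$ is the Levi-Civita connection of $g$, vanishes everywhere. -/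

import Mathlib

open scoped Manifold ContDiff

namespace NKSL2

/-- Real `2 × 2` matrices. -/
abbrev Mat : Type := Matrix (Fin 2) (Fin 2) ℝ

/-- The vector space `M(2,ℝ) × M(2,ℝ) = ℝ⁸` in which `SL(2,ℝ) × SL(2,ℝ)` is embedded. -/
abbrev Amb : Type := Mat × Mat

/-- `ℝ⁸` as a normed space (`Matrix` carries no canonical norm); the norm only serves to speak of
smooth maps into `M(2,ℝ) × M(2,ℝ)` and of their derivatives. -/
abbrev Euc : Type := (Fin 2 → Fin 2 → ℝ) × (Fin 2 → Fin 2 → ℝ)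

/-- The identification of `M(2,ℝ) × M(2,ℝ)` with `ℝ⁸` by the matrix entries. -/
def toEuc : Amb ≃ₗ[ℝ] Euc :=
  LinearEquiv.prodCongr (Matrix.ofLinearEquiv ℝ).symm (Matrix.ofLinearEquiv ℝ).symm

/-- The Lie group `SL(2,ℝ) × SL(2,ℝ)`. -/
abbrev SLSL : Type :=
  Matrix.SpecialLinearGroup (Fin 2) ℝ × Matrix.SpecialLinearGroup (Fin 2) ℝ

/-- The inclusion `SL(2,ℝ) × SL(2,ℝ) ⊆ ℝ⁸`. -/
def incl (p : SLSL) : Amb := ((p.1 : Mat), (p.2 : Mat))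

/-- Left translation `(α, β) ↦ (aα, bβ)` with `p = (a, b)`. -/
def leftMul (p : SLSL) (u : Amb) : Amb := ((p.1 : Mat) * u.1, (p.2 : Mat) * u.2)

/-- Left trivialisation `(aα, bβ) ↦ (α, β)` with `p = (a, b)`. -/
def leftTriv (p : SLSL) (X : Amb) : Amb := leftMul p⁻¹ X

/-- The tangent space `{(aα, bβ) : α, β ∈ 𝔰𝔩(2,ℝ)}` of `SL(2,ℝ) × SL(2,ℝ)` at `p = (a, b)`. -/
def tangentAt (p : SLSL) : Set Amb :=
  {X | (leftTriv p X).1.trace = 0 ∧ (leftTriv p X).2.trace = 0}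

/-- The inner product `⟨a, b⟩ = -½ tr(adj(a) b)` on `M(2,ℝ)`. -/
noncomputable def matInner (a b : Mat) : ℝ := -(1 / 2) * (a.adjugate * b).trace

/-- The product metric `⟨X, Y⟩`. -/
noncomputable def prodMetric (X Y : Amb) : ℝ := matInner X.1 Y.1 + matInner X.2 Y.2

/-- The almost product structure `P(aα, bβ) = (aβ, bα)` at `p = (a, b)`. -/
def almostProd (p : SLSL) (X : Amb) : Amb := leftMul p ((leftTriv p X).2, (leftTriv p X).1)

/-- The almost complex structure `J(aα, bβ) = (1/√3) (a(α - 2β), b(2α - β))` at `p = (a, b)`. -/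
noncomputable def almostCpx (p : SLSL) (X : Amb) : Amb :=
  (1 / √3 : ℝ) • leftMul p
    ((leftTriv p X).1 - (2 : ℝ) • (leftTriv p X).2, (2 : ℝ) • (leftTriv p X).1 - (leftTriv p X).2)

/-- The nearly Kähler metric
`g((aα, bβ), (aγ, bδ)) = ⅔ ⟨(aα, bβ), (aγ, bδ)⟩ - ⅓ ⟨(aβ, bα), (aγ, bδ)⟩` at `p = (a, b)`. -/
noncomputable def nkMetric (p : SLSL) (X Y : Amb) : ℝ :=
  2 / 3 * prodMetric X Y - 1 / 3 * prodMetric (almostProd p X) Y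

/-- The Lie bracket on `𝔰𝔩(2,ℝ) × 𝔰𝔩(2,ℝ)` (of pairs of matrices). -/
def bracket (u v : Amb) : Amb := (u.1 * v.1 - v.1 * u.1, u.2 * v.2 - v.2 * u.2)

/-- The Levi-Civita connection of the left-invariant metric `g`, evaluated on left-invariant
vector fields: for `u, v` in the Lie algebra, `∇̃_u v = Γ(u, v)`. By `gamma_torsion_free`,
`gamma_metric` and `gamma_unique` it is the only bilinear product that is torsion-free and
compatible with `g`. -/
noncomputable def gamma (u v : Amb) : Amb :=
  (1 / 2 : ℝ) • bracket u v +
    (1 / 6 : ℝ) • ((u.2 * v.1 - v.1 * u.2) - (u.1 * v.2 - v.2 * u.1),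
      -((u.2 * v.1 - v.1 * u.2) - (u.1 * v.2 - v.2 * u.1)))

theorem leftTriv_leftMul (p : SLSL) (u : Amb) : leftTriv p (leftMul p u) = u := by
  ext1 <;> simp [leftTriv, leftMul, ← mul_assoc, Matrix.adjugate_mul]

theorem leftMul_leftTriv (p : SLSL) (u : Amb) : leftMul p (leftTriv p u) = u := by
  ext1 <;> simp [leftTriv, leftMul, ← mul_assoc, Matrix.mul_adjugate]

/-- `g` is left-invariant. -/
theorem nkMetric_leftMul (p : SLSL) (u v : Amb) :
    nkMetric p (leftMul p u) (leftMul p v) = nkMetric 1 u v := by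
  have key : ∀ (a : Matrix.SpecialLinearGroup (Fin 2) ℝ) (x y : Mat),
      matInner ((a : Mat) * x) ((a : Mat) * y) = matInner x y := by
    intro a x y
    have h : (x.adjugate * (a : Mat).adjugate) * ((a : Mat) * y) = x.adjugate * y := by
      rw [mul_assoc, ← mul_assoc (a : Mat).adjugate, Matrix.adjugate_mul, a.det_coe, one_smul,
        one_mul]
    simp only [matInner, Matrix.adjugate_mul_distrib, h]
  have h1 : ∀ w : Amb, leftMul 1 w = w := fun w => by ext1 <;> simp [leftMul]
  simp only [nkMetric, almostProd, leftTriv_leftMul, prodMetric]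
  simp only [leftMul, key]
  simp [leftTriv, leftMul]

theorem matInner_eq (a b : Mat) : matInner a b =
    -(1 / 2) * (a 1 1 * b 0 0 - a 0 1 * b 1 0 - a 1 0 * b 0 1 + a 0 0 * b 1 1) := by
  rw [matInner, Matrix.trace_fin_two, Matrix.mul_apply, Matrix.mul_apply, Fin.sum_univ_two,
    Fin.sum_univ_two, Matrix.adjugate_fin_two]
  simp
  ring

theorem nkMetric_one (u v : Amb) : nkMetric 1 u v = 2 / 3 * (matInner u.1 v.1 + matInner u.2 v.2) -
    1 / 3 * (matInner u.2 v.1 + matInner u.1 v.2) := by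
  simp [nkMetric, almostProd, prodMetric, leftMul, leftTriv]

theorem gamma_torsion_free (u v : Amb) : gamma u v - gamma v u = bracket u v := by
  obtain ⟨a, b⟩ := u
  obtain ⟨c, d⟩ := v
  ext1 <;> simp only [gamma, bracket, Prod.fst_sub, Prod.snd_sub, Prod.fst_add, Prod.snd_add,
    Prod.smul_fst, Prod.smul_snd] <;> module

theorem gamma_metric (u v w : Amb) : nkMetric 1 (gamma u v) w + nkMetric 1 v (gamma u w) = 0 := by
  obtain ⟨a, b⟩ := u
  obtain ⟨c, d⟩ := v
  obtain ⟨e, f⟩ := w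
  simp only [nkMetric_one, matInner_eq, gamma, bracket, Prod.fst_add, Prod.snd_add, Prod.smul_fst,
    Prod.smul_snd, Matrix.add_apply, Matrix.sub_apply, Matrix.neg_apply, Matrix.smul_apply,
    Matrix.mul_apply, Fin.sum_univ_two, smul_eq_mul]
  ring

/-- `g` is nondegenerate on the Lie algebra. -/
theorem nkMetric_nondegenerate (u : Amb) (hu : u ∈ tangentAt 1)
    (h : ∀ w ∈ tangentAt 1, nkMetric 1 u w = 0) : u = 0 := by
  obtain ⟨a, b⟩ := u
  have hu' : a 0 0 + a 1 1 = 0 ∧ b 0 0 + b 1 1 = 0 := by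
    simpa [tangentAt, leftTriv, leftMul, Matrix.trace_fin_two] using hu
  have key : ∀ x y z x' y' z' : ℝ,
      nkMetric 1 (a, b) (!![x, y; z, -x], !![x', y'; z', -x']) = 0 := fun x y z x' y' z' =>
    h _ (by simp [tangentAt, leftTriv, leftMul, Matrix.trace_fin_two])
  have k1 := key 1 0 0 0 0 0
  have k2 := key 0 1 0 0 0 0
  have k3 := key 0 0 1 0 0 0
  have k4 := key 0 0 0 1 0 0
  have k5 := key 0 0 0 0 1 0
  have k6 := key 0 0 0 0 0 1
  simp [nkMetric_one, matInner_eq] at k1 k2 k3 k4 k5 k6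
  ext i j <;> fin_cases i <;> fin_cases j <;> simp <;> linarith

/-- The Koszul argument: a torsion-free metric product on the Lie algebra equals `gamma`. -/
theorem gamma_unique (Γ : Amb → Amb → Amb)
    (hmem : ∀ u ∈ tangentAt 1, ∀ v ∈ tangentAt 1, Γ u v ∈ tangentAt 1)
    (htor : ∀ u ∈ tangentAt 1, ∀ v ∈ tangentAt 1, Γ u v - Γ v u = bracket u v)
    (hmet : ∀ u ∈ tangentAt 1, ∀ v ∈ tangentAt 1, ∀ w ∈ tangentAt 1,
      nkMetric 1 (Γ u v) w + nkMetric 1 v (Γ u w) = 0)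
    (u : Amb) (hu : u ∈ tangentAt 1) (v : Amb) (hv : v ∈ tangentAt 1) :
    Γ u v = gamma u v := by
  have gsub : ∀ x y z : Amb, nkMetric 1 (x - y) z = nkMetric 1 x z - nkMetric 1 y z := by
    intro x y z
    simp only [nkMetric_one, matInner_eq, Prod.fst_sub, Prod.snd_sub, Matrix.sub_apply]
    ring
  have gsymm : ∀ x y : Amb, nkMetric 1 x y = nkMetric 1 y x := by
    intro x y
    simp only [nkMetric_one, matInner_eq]
    ring
  have gam : ∀ x y : Amb, gamma x y ∈ tangentAt 1 := by
    intro x y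
    simp [gamma, bracket, tangentAt, leftMul, leftTriv, Matrix.trace_fin_two, Matrix.mul_apply,
      Fin.sum_univ_two]
    constructor <;> ring
  have sub : ∀ x ∈ tangentAt 1, ∀ y ∈ tangentAt 1, x - y ∈ tangentAt 1 := by
    intro x hx y hy
    simp only [tangentAt, leftMul, leftTriv, Set.mem_ofPred_eq, inv_one, Prod.fst_one,
      Prod.snd_one, Matrix.SpecialLinearGroup.coe_one, one_mul, Prod.fst_sub, Prod.snd_sub,
      Matrix.trace_sub] at hx hy ⊢
    exact ⟨by rw [hx.1, hy.1, sub_zero], by rw [hx.2, hy.2, sub_zero]⟩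
  -- The difference tensor is symmetric in its arguments and skew for the metric.
  have dsym : ∀ x ∈ tangentAt 1, ∀ y ∈ tangentAt 1,
      Γ x y - gamma x y = Γ y x - gamma y x := by
    intro x hx y hy
    have h := (htor x hx y hy).trans (gamma_torsion_free x y).symm
    rw [sub_eq_sub_iff_add_eq_add] at h ⊢
    rw [h]; abel
  have dskew : ∀ x ∈ tangentAt 1, ∀ y ∈ tangentAt 1, ∀ z ∈ tangentAt 1,
      nkMetric 1 (Γ x y - gamma x y) z = - nkMetric 1 (Γ x z - gamma x z) y := by
    intro x hx y hy z hz
    have h1 := hmet x hx y hy z hz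
    have h2 := gamma_metric x y z
    rw [gsub, gsub, gsymm (Γ x z), gsymm (gamma x z)]
    linarith
  have : Γ u v - gamma u v = 0 := by
    refine nkMetric_nondegenerate _ (sub _ (hmem u hu v hv) _ (gam u v)) fun w hw => ?_
    have e1 := dskew u hu v hv w hw
    have e2 := dskew w hw u hu v hv
    have e3 := dskew v hv w hw u hu
    rw [dsym u hu w hw] at e1
    rw [dsym w hw v hv] at e2
    rw [dsym v hv u hu] at e3
    linarith
  exact sub_eq_zero.mp this

section Immersions

variable {M : Type*} [TopologicalSpace M] [ChartedSpace (EuclideanSpace ℝ (Fin 3)) M]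
  [IsManifold (𝓡 3) ∞ M]

/-- The (componentwise) derivative at `q` of a map `F : M → M(2,ℝ) × M(2,ℝ)`. -/
noncomputable def ambDeriv (F : M → Amb) (q : M) : TangentSpace (𝓡 3) q →ₗ[ℝ] Amb :=
  toEuc.symm.toLinearMap ∘ₗ
    (mfderiv (𝓡 3) 𝓘(ℝ, Euc) (fun x => toEuc (F x)) q).toLinearMap

/-- The differential `df_q : T_q M → T_{f(q)}(SL(2,ℝ) × SL(2,ℝ)) ⊆ ℝ⁸`. -/
noncomputable def dmap (f : M → SLSL) (q : M) : TangentSpace (𝓡 3) q →ₗ[ℝ] Amb :=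
  ambDeriv (fun x => incl (f x)) q

/-- Smoothness on `U` of a vector field of `M`. -/
def SmoothFieldOn (X : (q : M) → TangentSpace (𝓡 3) q) (U : Set M) : Prop :=
  ContMDiffOn (𝓡 3) (𝓡 3).tangent ∞ (fun q => (⟨q, X q⟩ : TangentBundle (𝓡 3) M)) U

/-- `ξ` is a normal vector of `f` at `q`. -/
def IsNormalVector (f : M → SLSL) (q : M) (ξ : Amb) : Prop :=
  ξ ∈ tangentAt (f q) ∧ ∀ v : TangentSpace (𝓡 3) q, nkMetric (f q) (dmap f q v) ξ = 0

/-- `f` is a Lagrangian immersion of the `3`-manifold `M` into `(SL(2,ℝ) × SL(2,ℝ), g, J)`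
with nondegenerate induced metric. -/
structure IsLagrangianImmersion (f : M → SLSL) : Prop where
  smooth : ContMDiff (𝓡 3) 𝓘(ℝ, Euc) ∞ (fun q => toEuc (incl (f q)))
  immersion : ∀ q, Function.Injective (dmap f q)
  nondegenerate : ∀ (q : M) (v : TangentSpace (𝓡 3) q),
    (∀ w : TangentSpace (𝓡 3) q, nkMetric (f q) (dmap f q v) (dmap f q w) = 0) → v = 0
  tangent_to_normal : ∀ (q : M) (v : TangentSpace (𝓡 3) q),
    IsNormalVector f q (almostCpx (f q) (dmap f q v))
  normal_to_tangent : ∀ (q : M) (ξ : Amb), IsNormalVector f q ξ →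
    ∃ v : TangentSpace (𝓡 3) q, almostCpx (f q) ξ = dmap f q v

/-- The Levi-Civita covariant derivative `∇̃_v Y ∈ T_{f(q)}(SL(2,ℝ) × SL(2,ℝ))`, for `v ∈ T_q M`,
of a vector field `Y` along `f`. Writing `Y = f · η` in the left-invariant frame, the Leibniz rule
gives `∇̃_v Y = f(q) · (dη(v) + Γ(f(q)⁻¹ df(v), η(q)))`. -/
noncomputable def covDeriv (f : M → SLSL) (Y : M → Amb) (q : M) (v : TangentSpace (𝓡 3) q) :
    Amb :=
  leftMul (f q)
    (ambDeriv (fun x => leftTriv (f x) (Y x)) q v +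
      gamma (leftTriv (f q) (dmap f q v)) (leftTriv (f q) (Y q)))

/-- `h` is the value `h(X, Y)(q)` of the second fundamental form: it is the normal part of
`∇̃_X df(Y)` in the Gauss formula `∇̃_X df(Y) = df(∇_X Y) + h(X, Y)`. -/
def HasSecondFundamentalForm (f : M → SLSL) (X Y : (q : M) → TangentSpace (𝓡 3) q) (q : M)
    (h : Amb) : Prop :=
  IsNormalVector f q h ∧
    ∃ z : TangentSpace (𝓡 3) q, covDeriv f (fun x => dmap f x (Y x)) q (X q) = dmap f q z + h

/-- `f` is totally geodesic: `h(X, Y)` vanishes everywhere, for all (local) smooth fields. -/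
def IsTotallyGeodesic (f : M → SLSL) : Prop :=
  ∀ U : Set M, IsOpen U → ∀ X Y : (q : M) → TangentSpace (𝓡 3) q,
    SmoothFieldOn X U → SmoothFieldOn Y U → ∀ q ∈ U, HasSecondFundamentalForm f X Y q 0

/-- `P|_M = A + JB` at the point `q`, with endomorphisms `A, B` of `T_q M`. -/
def IsDecompositionOfP (f : M → SLSL) (q : M)
    (A B : TangentSpace (𝓡 3) q →ₗ[ℝ] TangentSpace (𝓡 3) q) : Prop :=
  ∀ v : TangentSpace (𝓡 3) q,
    almostProd (f q) (dmap f q v) = dmap f q (A v) + almostCpx (f q) (dmap f q (B v))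

/-- `Δ₁ = diag(-1, 1, 1)`. -/
def delta1 : Matrix (Fin 3) (Fin 3) ℝ := Matrix.diagonal ![-1, 1, 1]

/-- On `U`, `E` is a smooth `Δ₁`-orthonormal frame in which `A = diag(cos 2θᵢ)` and
`B = diag(sin 2θᵢ)`, where `P|_M = A + JB`: the immersion is of diagonalizable type on `U`, with
angle functions `θ₁, θ₂, θ₃`. -/
structure IsDiagonalizingFrame (f : M → SLSL) (U : Set M)
    (E : Fin 3 → (q : M) → TangentSpace (𝓡 3) q) (θ : Fin 3 → M → ℝ) : Prop where
  smooth : ∀ i, SmoothFieldOn (E i) U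
  orthonormal : ∀ q ∈ U, ∀ i j, nkMetric (f q) (dmap f q (E i q)) (dmap f q (E j q)) = delta1 i j
  diagonal : ∀ q ∈ U, ∃ A B : TangentSpace (𝓡 3) q →ₗ[ℝ] TangentSpace (𝓡 3) q,
    IsDecompositionOfP f q A B ∧
      ∀ i, A (E i q) = Real.cos (2 * θ i q) • E i q ∧ B (E i q) = Real.sin (2 * θ i q) • E i q

end Immersions

end NKSL2

open NKSL2

/-!
The argument is pointwise linear algebra in the left trivialisation, fed by three facts from
calculus: the product rule, the Maurer-Cartan equation, and one use of the Lie bracket of two frame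
fields. All the structure tensors `J`, `P`, `g` are left-invariant, so in the left trivialisation
they are constant and commute with directional derivatives.

Let `eᵢ` be the trivialised frame. Since `P J = -J P`, the equation
`P eᵢ = cos 2θᵢ eᵢ + sin 2θᵢ J eᵢ` says that `e^{Jθᵢ} eᵢ` is fixed by `P`, that is
`eᵢ = e^{-Jθᵢ} (αᵢ, αᵢ)` with `αᵢ` orthogonal in `𝔰𝔩(2,ℝ)`. Hence `g([eᵢ, eⱼ], eₖ)` and
`g(Γ(eᵢ, eⱼ), J eₖ)` are explicit trigonometric multiples of the triple product `⟨[αᵢ, αⱼ], αₖ⟩`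
(`lieMetric_bracket_rot`, `lieMetric_gamma_rot`), which is nonzero for distinct indices.
Write `hᵢⱼₖ = g(∇̃_{eᵢ} eⱼ, J eₖ)`.

* `FrameJet.sff_swap`, `FrameJet.sin_angle_sum`, `FrameJet.sff_symm`: torsion-freeness makes `h`
  symmetric in the first two indices, the Lagrangian condition controls the exchange of the last
  two, and going around the cycle of the six permutations gives `sin (θ₁ + θ₂ + θ₃) = 0`, after
  which `h` is totally symmetric.
* `FrameJet.normalPart_mul_cos`, `FrameJet.deriv_angle`: differentiating the equation for `P eᵢ`
  relates `h` to the tangential connection coefficients off the diagonal, and shows that the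
  diagonal entries `hⱼᵢᵢ` are, up to sign, the derivatives `eⱼ(θᵢ)`.

Let `θ_p = θ_q` modulo `π`, and let `r` be the third index, so that `θ_r = -2 θ_p` modulo `π`. Then
`hⱼ_pq = 0` for all `j`, and comparing derivatives of the angles leaves only components proportional
to `h_ppr`, the derivative of `θ_p` along `e_r`; moreover `θ_p` is constant along `e_p` and
`e_q`, hence also along `[e_p, e_q]`. Where `sin (θ_r - θ_p) = 0` the equation off the diagonal
gives `h_ppr = 0`. Elsewhere it determines the connection coefficients so that `[e_p, e_q]` has a
nonzero component along `e_r` (`FrameJet.bracket_coeff_ne_zero`), so that `θ_p` is constant along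
`e_r` too and again `h_ppr = 0`.

The angle functions are not assumed continuous. Only `cos 2θᵢ` and `sin 2θᵢ` are differentiated;
these are smooth because they are components of `P` in the frame.
-/

namespace NKSL2

/-! ### Directional derivatives on a manifold -/

section Calculus

variable {M : Type*} [TopologicalSpace M] [ChartedSpace (EuclideanSpace ℝ (Fin 3)) M]
  [IsManifold (𝓡 3) ∞ M]
  {N : Type*} [NormedAddCommGroup N] [NormedSpace ℝ N]

theorem contMDiffAt_chart_symm (q : M) :
    ContMDiffAt 𝓘(ℝ, EuclideanSpace ℝ (Fin 3)) (𝓡 3) ∞ (extChartAt (𝓡 3) q).symm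
      (extChartAt (𝓡 3) q q) :=
  (contMDiffOn_extChartAt_symm q).contMDiffAt (extChartAt_target_mem_nhds q)

/-- The derivative of `G : M → N` at `q` in the direction of a tangent vector. -/
noncomputable def dirDeriv (G : M → N) (q : M) : TangentSpace (𝓡 3) q →ₗ[ℝ] N :=
  (mfderiv (𝓡 3) 𝓘(ℝ, N) G q).toLinearMap

omit [IsManifold (𝓡 3) ∞ M] in
/-- `TangentSpace (𝓡 3) q` is modelled on the preferred chart at `q`, so the derivative at `q`
itself is the derivative of the chart expression. -/
theorem dirDeriv_eq_fderiv_center {G : M → N} {q : M}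
    (hG : MDifferentiableAt (𝓡 3) 𝓘(ℝ, N) G q) (v : TangentSpace (𝓡 3) q) :
    dirDeriv G q v =
      fderiv ℝ (G ∘ (extChartAt (𝓡 3) q).symm) (extChartAt (𝓡 3) q q) v := by
  have h : Set.range (𝓡 3) = Set.univ := by simp
  have h2 : ∀ s : Set (EuclideanSpace ℝ (Fin 3)), s = Set.univ →
      (fderivWithin ℝ (G ∘ (extChartAt (𝓡 3) q).symm) s (extChartAt (𝓡 3) q q) =
      fderiv ℝ (G ∘ (extChartAt (𝓡 3) q).symm) (extChartAt (𝓡 3) q q)) := by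
    rintro s rfl; rw [fderivWithin_univ]
  have h3 : mfderiv (𝓡 3) 𝓘(ℝ, N) G q =
      fderiv ℝ (G ∘ (extChartAt (𝓡 3) q).symm) (extChartAt (𝓡 3) q q) :=
    (MDifferentiableAt.mfderiv hG).trans (h2 _ h)
  exact DFunLike.congr_fun h3 v

theorem dirDeriv_eq_fderiv_chart {G : M → N} {q x : M}
    (hx : x ∈ (chartAt (EuclideanSpace ℝ (Fin 3)) q).source)
    (hG : MDifferentiableAt (𝓡 3) 𝓘(ℝ, N) G x) (v : TangentSpace (𝓡 3) x) :
    dirDeriv G x v =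
      fderiv ℝ (G ∘ (extChartAt (𝓡 3) q).symm) (extChartAt (𝓡 3) q x)
        (dirDeriv (extChartAt (𝓡 3) q) x v) := by
  have : IsManifold (𝓡 3) 1 M := IsManifold.of_le (n := ∞) (by simp)
  have hxs : x ∈ (extChartAt (𝓡 3) q).source := by simpa using hx
  have hψ : MDifferentiableAt 𝓘(ℝ, EuclideanSpace ℝ (Fin 3)) (𝓡 3) (extChartAt (𝓡 3) q).symm
      (extChartAt (𝓡 3) q x) :=
    ((contMDiffOn_extChartAt_symm (n := 1) q).contMDiffAt
      ((isOpen_extChartAt_target q).mem_nhds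
        ((extChartAt (𝓡 3) q).map_source hxs))).mdifferentiableAt one_ne_zero
  have hx' : (extChartAt (𝓡 3) q).symm (extChartAt (𝓡 3) q x) = x :=
    (extChartAt (𝓡 3) q).left_inv hxs
  have hGψ : MDifferentiableAt 𝓘(ℝ, EuclideanSpace ℝ (Fin 3)) 𝓘(ℝ, N)
      (G ∘ (extChartAt (𝓡 3) q).symm) (extChartAt (𝓡 3) q x) :=
    MDifferentiableAt.comp _ (by rw [hx']; exact hG) hψ
  have hev : (G ∘ (extChartAt (𝓡 3) q).symm) ∘ extChartAt (𝓡 3) q =ᶠ[nhds x] G := by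
    filter_upwards [(isOpen_extChartAt_source q).mem_nhds hxs] with y hy
    exact congrArg G ((extChartAt (𝓡 3) q).left_inv hy)
  have h3 : HasMFDerivAt (𝓡 3) 𝓘(ℝ, N) ((G ∘ (extChartAt (𝓡 3) q).symm) ∘ extChartAt (𝓡 3) q) x _ :=
    HasMFDerivAt.comp x hGψ.hasMFDerivAt (mdifferentiableAt_extChartAt hx).hasMFDerivAt
  have h4 := (h3.congr_of_eventuallyEq hev.symm).mfderiv
  have h5 := congrArg (fun L => L v) h4
  have h6 : (mfderiv 𝓘(ℝ, EuclideanSpace ℝ (Fin 3)) 𝓘(ℝ, N)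
      (G ∘ (extChartAt (𝓡 3) q).symm) (extChartAt (𝓡 3) q x)) = fderiv ℝ _ _ := mfderiv_eq_fderiv
  refine h5.trans ?_
  exact congrArg (fun L : EuclideanSpace ℝ (Fin 3) →L[ℝ] N =>
    L (dirDeriv (extChartAt (𝓡 3) q) x v)) h6

/-- The expression in the preferred chart at `q` of a vector field of `M`. -/
noncomputable def chartField (q : M) (Y : (q : M) → TangentSpace (𝓡 3) q)
    (y : EuclideanSpace ℝ (Fin 3)) : EuclideanSpace ℝ (Fin 3) :=
  dirDeriv (extChartAt (𝓡 3) q) ((extChartAt (𝓡 3) q).symm y) (Y ((extChartAt (𝓡 3) q).symm y))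

theorem chartField_center (q : M) (Y : (q : M) → TangentSpace (𝓡 3) q) :
    chartField q Y (extChartAt (𝓡 3) q q) = Y q := by
  have : IsManifold (𝓡 3) 1 M := IsManifold.of_le (n := ∞) (by simp)
  have h : ∀ x, x = q → dirDeriv (extChartAt (𝓡 3) q) x (Y x) = Y q := by
    rintro x rfl
    exact congrArg (fun L => L (Y x)) (mfderiv_extChartAt_self (I := 𝓡 3) (x := x))
  exact h _ (extChartAt_to_inv q)

theorem contDiffAt_chartField {q : M} {Y : (q : M) → TangentSpace (𝓡 3) q} {U : Set M}
    (hU : IsOpen U) (hq : q ∈ U) (hY : SmoothFieldOn Y U) :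
    ContDiffAt ℝ ∞ (chartField q Y) (extChartAt (𝓡 3) q q) := by
  have : IsManifold (𝓡 3) 1 M := IsManifold.of_le (n := ∞) (by simp)
  have h1 : ContMDiffAt (𝓡 3) (𝓡 3).tangent ∞ (fun q => (⟨q, Y q⟩ : TangentBundle (𝓡 3) M)) q :=
    hY.contMDiffAt (hU.mem_nhds hq)
  rw [Bundle.contMDiffAt_section] at h1
  have hq' : (extChartAt (𝓡 3) q).symm (extChartAt (𝓡 3) q q) = q := extChartAt_to_inv q
  have h2 := ContMDiffAt.comp_of_eq h1 (contMDiffAt_chart_symm q) hq'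
  rw [contMDiffAt_iff_contDiffAt] at h2
  refine h2.congr_of_eventuallyEq ?_
  filter_upwards [extChartAt_target_mem_nhds (I := 𝓡 3) q] with y hy
  have hs : (extChartAt (𝓡 3) q).symm y ∈ (chartAt (EuclideanSpace ℝ (Fin 3)) q).source := by
    simpa using (extChartAt (𝓡 3) q).map_target hy
  have e1 := congrArg (fun L => L (Y ((extChartAt (𝓡 3) q).symm y)))
    (TangentBundle.continuousLinearMapAt_trivializationAt (I := 𝓡 3) hs)
  refine e1.symm.trans ?_
  have e2 := Bundle.Trivialization.continuousLinearMapAt_apply ℝ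
    (trivializationAt (EuclideanSpace ℝ (Fin 3)) (TangentSpace (𝓡 3) (M := M)) q)
    (b := (extChartAt (𝓡 3) q).symm y)
  refine (congrArg (fun L => L (Y ((extChartAt (𝓡 3) q).symm y))) e2).trans ?_
  rw [Bundle.Trivialization.linearMapAt_apply, if_pos (by simpa using hs)]
  rfl

/-- The derivative of `G` along the field `Y`, in the chart. -/
theorem dirDeriv_field_comp_chart {q : M} {Y : (q : M) → TangentSpace (𝓡 3) q} {U : Set M}
    {G : M → N} (hU : IsOpen U) (hq : q ∈ U) (hG : ContMDiffOn (𝓡 3) 𝓘(ℝ, N) ∞ G U) :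
    ((fun x => dirDeriv G x (Y x)) ∘ (extChartAt (𝓡 3) q).symm)
      =ᶠ[nhds (extChartAt (𝓡 3) q q)]
      fun y => fderiv ℝ (G ∘ (extChartAt (𝓡 3) q).symm) y (chartField q Y y) := by
  have hq' : (extChartAt (𝓡 3) q).symm (extChartAt (𝓡 3) q q) = q := extChartAt_to_inv q
  have hc := (contMDiffAt_chart_symm q).continuousAt
  have hV : (extChartAt (𝓡 3) q).symm ⁻¹' U ∈ nhds (extChartAt (𝓡 3) q q) :=
    hc (by rw [hq']; exact hU.mem_nhds hq)
  filter_upwards [extChartAt_target_mem_nhds (I := 𝓡 3) q, hV] with y hy hyU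
  have hs : (extChartAt (𝓡 3) q).symm y ∈ (chartAt (EuclideanSpace ℝ (Fin 3)) q).source := by
    simpa using (extChartAt (𝓡 3) q).map_target hy
  have := dirDeriv_eq_fderiv_chart hs
    ((hG.contMDiffAt (hU.mem_nhds hyU)).mdifferentiableAt (by simp)) (Y _)
  rw [(extChartAt (𝓡 3) q).right_inv hy] at this
  exact this

theorem contDiffAt_comp_chart {q : M} {U : Set M}
    {G : M → N} (hU : IsOpen U) (hq : q ∈ U) (hG : ContMDiffOn (𝓡 3) 𝓘(ℝ, N) ∞ G U) :
    ContDiffAt ℝ ∞ (G ∘ (extChartAt (𝓡 3) q).symm) (extChartAt (𝓡 3) q q) := by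
  rw [← contMDiffAt_iff_contDiffAt]
  exact ContMDiffAt.comp_of_eq (hG.contMDiffAt (hU.mem_nhds hq)) (contMDiffAt_chart_symm q)
    (extChartAt_to_inv q)

theorem contMDiffOn_dirDeriv_field {Y : (q : M) → TangentSpace (𝓡 3) q} {U : Set M}
    {G : M → N} (hU : IsOpen U) (hG : ContMDiffOn (𝓡 3) 𝓘(ℝ, N) ∞ G U)
    (hY : SmoothFieldOn Y U) :
    ContMDiffOn (𝓡 3) 𝓘(ℝ, N) ∞ (fun x => dirDeriv G x (Y x)) U := by
  intro q hq
  apply ContMDiffAt.contMDiffWithinAt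
  have h1 : ContDiffAt ℝ ∞
      (fun y => fderiv ℝ (G ∘ (extChartAt (𝓡 3) q).symm) y (chartField q Y y))
      (extChartAt (𝓡 3) q q) :=
    ((contDiffAt_comp_chart hU hq hG).fderiv_right (by simp)).clm_apply
      (contDiffAt_chartField hU hq hY)
  have h2 := h1.congr_of_eventuallyEq (dirDeriv_field_comp_chart (Y := Y) hU hq hG)
  rw [← contMDiffAt_iff_contDiffAt] at h2
  have h3 := h2.comp q (contMDiffAt_extChartAt (x := q))
  refine h3.congr_of_eventuallyEq ?_
  filter_upwards [extChartAt_source_mem_nhds (I := 𝓡 3) q] with y hy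
  have e : ∀ z, z = y → dirDeriv G y (Y y) = dirDeriv G z (Y z) := by rintro z rfl; rfl
  exact e _ ((extChartAt (𝓡 3) q).left_inv hy)

/-- Directional derivatives along two vector fields commute up to the directional derivative along a
third one, their Lie bracket, which does not depend on the function. -/
theorem exists_bracket {q : M} {X Y : (q : M) → TangentSpace (𝓡 3) q} {U : Set M}
    (hU : IsOpen U) (hq : q ∈ U) (hX : SmoothFieldOn X U) (hY : SmoothFieldOn Y U) :
    ∃ Z : TangentSpace (𝓡 3) q, ∀ (N : Type) [NormedAddCommGroup N] [NormedSpace ℝ N] (G : M → N),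
      ContMDiffOn (𝓡 3) 𝓘(ℝ, N) ∞ G U →
      dirDeriv G q Z =
        dirDeriv (fun x => dirDeriv G x (Y x)) q (X q) -
        dirDeriv (fun x => dirDeriv G x (X x)) q (Y q) := by
  refine ⟨(VectorField.lieBracket ℝ (chartField q X) (chartField q Y) (extChartAt (𝓡 3) q q) :
    EuclideanSpace ℝ (Fin 3)), ?_⟩
  intro N _ _ G hG
  have md : ∀ {H : M → N}, ContMDiffOn (𝓡 3) 𝓘(ℝ, N) ∞ H U →
      MDifferentiableAt (𝓡 3) 𝓘(ℝ, N) H q := fun h =>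
    (h.contMDiffAt (hU.mem_nhds hq)).mdifferentiableAt (by simp)
  refine (dirDeriv_eq_fderiv_center (md hG) _).trans ?_
  rw [dirDeriv_eq_fderiv_center (md (contMDiffOn_dirDeriv_field hU hG hY)),
    dirDeriv_eq_fderiv_center (md (contMDiffOn_dirDeriv_field hU hG hX)),
    (dirDeriv_field_comp_chart hU hq hG).fderiv_eq, (dirDeriv_field_comp_chart hU hq hG).fderiv_eq]
  have h := VectorField.fderiv_apply_lieBracket (contDiffAt_comp_chart hU hq hG)
    (by rw [minSmoothness_of_isRCLikeNormedField]; exact WithTop.coe_le_coe.2 le_top)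
    ((contDiffAt_chartField hU hq hY).differentiableAt (by simp))
    ((contDiffAt_chartField hU hq hX).differentiableAt (by simp))
  rw [chartField_center, chartField_center] at h
  exact h

end Calculus

/-! ### The Lie algebra: metric, almost complex and almost product structure -/

/-- The value at the identity of the left-invariant almost complex structure `J`. -/
noncomputable def lieJ : Amb →ₗ[ℝ] Amb where
  toFun u := (1 / √3 : ℝ) • (u.1 - (2 : ℝ) • u.2, (2 : ℝ) • u.1 - u.2)
  map_add' u v := by
    ext1 <;> simp only [Prod.fst_add, Prod.snd_add, Prod.smul_fst, Prod.smul_snd] <;> module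
  map_smul' c u := by
    ext1 <;> simp only [Prod.smul_fst, Prod.smul_snd, RingHom.id_apply] <;> module

/-- The value at the identity of the left-invariant almost product structure `P`. -/
def lieP : Amb →ₗ[ℝ] Amb where
  toFun u := (u.2, u.1)
  map_add' _ _ := rfl
  map_smul' _ _ := rfl

/-- The value at the identity of the left-invariant metric `g`, as a bilinear form. -/
noncomputable def lieMetric : Amb →ₗ[ℝ] Amb →ₗ[ℝ] ℝ :=
  LinearMap.mk₂ ℝ (nkMetric 1)
    (fun u v w => by
      simp only [nkMetric_one, matInner_eq, Prod.fst_add, Prod.snd_add, Matrix.add_apply]; ring)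
    (fun c u v => by
      simp only [nkMetric_one, matInner_eq, Prod.smul_fst, Prod.smul_snd, Matrix.smul_apply,
        smul_eq_mul]; ring)
    (fun u v w => by
      simp only [nkMetric_one, matInner_eq, Prod.fst_add, Prod.snd_add, Matrix.add_apply]; ring)
    (fun c u v => by
      simp only [nkMetric_one, matInner_eq, Prod.smul_fst, Prod.smul_snd, Matrix.smul_apply,
        smul_eq_mul]; ring)

theorem lieMetric_apply (u v : Amb) : lieMetric u v = nkMetric 1 u v := rfl

theorem sq_one_div_sqrt_three : (1 / √3 : ℝ) ^ 2 = 1 / 3 := by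
  rw [div_pow, Real.sq_sqrt (by norm_num)]; norm_num

theorem lieJ_lieJ (u : Amb) : lieJ (lieJ u) = -u := by
  have h := sq_one_div_sqrt_three
  ext1 <;> ext i j <;>
    simp only [lieJ, LinearMap.coe_mk, AddHom.coe_mk, Prod.smul_fst, Prod.smul_snd,
      Matrix.smul_apply, Matrix.sub_apply, smul_eq_mul, Prod.fst_neg, Prod.snd_neg,
      Matrix.neg_apply]
  · linear_combination (-3 * u.1 i j) * h
  · linear_combination (-3 * u.2 i j) * h

theorem lieP_lieJ (u : Amb) : lieP (lieJ u) = -lieJ (lieP u) := by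
  ext1 <;> simp only [lieJ, lieP, LinearMap.coe_mk, AddHom.coe_mk, Prod.smul_fst, Prod.smul_snd,
      Prod.fst_neg, Prod.snd_neg] <;> module

theorem lieMetric_symm (u v : Amb) : lieMetric u v = lieMetric v u := by
  simp only [lieMetric_apply, nkMetric_one, matInner_eq]
  ring

theorem lieMetric_lieJ_left (u v : Amb) : lieMetric (lieJ u) v = -lieMetric u (lieJ v) := by
  simp only [lieMetric_apply, nkMetric_one, matInner_eq, lieJ, LinearMap.coe_mk, AddHom.coe_mk,
    Prod.smul_fst, Prod.smul_snd, Matrix.smul_apply, Matrix.sub_apply, smul_eq_mul]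
  ring

theorem lieMetric_lieJ_lieJ (u v : Amb) : lieMetric (lieJ u) (lieJ v) = lieMetric u v := by
  rw [lieMetric_lieJ_left, lieJ_lieJ, map_neg, neg_neg]

theorem lieMetric_lieP_left (u v : Amb) : lieMetric (lieP u) v = lieMetric u (lieP v) := by
  simp only [lieMetric_apply, nkMetric_one, matInner_eq, lieP, LinearMap.coe_mk, AddHom.coe_mk]
  ring

/-- The triple product `⟨[α, β], γ⟩` of `2 × 2` matrices. -/
noncomputable def triple (α β γ : Mat) : ℝ := matInner (α * β - β * α) γ

theorem triple_eq (α β γ : Mat) : triple α β γ =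
    -(1 / 2) * ((α 1 0 * β 0 1 + α 1 1 * β 1 1 - β 1 0 * α 0 1 - β 1 1 * α 1 1) * γ 0 0
      - (α 0 0 * β 0 1 + α 0 1 * β 1 1 - β 0 0 * α 0 1 - β 0 1 * α 1 1) * γ 1 0
      - (α 1 0 * β 0 0 + α 1 1 * β 1 0 - β 1 0 * α 0 0 - β 1 1 * α 1 0) * γ 0 1
      + (α 0 0 * β 0 0 + α 0 1 * β 1 0 - β 0 0 * α 0 0 - β 0 1 * α 1 0) * γ 1 1) := by
  simp only [triple, matInner_eq, Matrix.sub_apply, Matrix.mul_apply, Fin.sum_univ_two]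
  ring

theorem triple_swap_left (α β γ : Mat) : triple β α γ = -triple α β γ := by
  simp only [triple_eq]; ring

theorem triple_swap_right (α β γ : Mat) : triple α γ β = -triple α β γ := by
  simp only [triple_eq]; ring

theorem triple_self_left (α γ : Mat) : triple α α γ = 0 := by
  simp only [triple_eq]; ring

theorem triple_self_right (α γ : Mat) : triple γ α α = 0 := by
  simp only [triple_eq]; ring

theorem triple_self_outer (α γ : Mat) : triple α γ α = 0 := by
  simp only [triple_eq]; ring

/-- On trace-free matrices the square of the triple product is a multiple of the Gram determinant,
here in the orthogonal case. -/
theorem triple_sq {α β γ : Mat} (hα : α.trace = 0) (hβ : β.trace = 0) (hγ : γ.trace = 0)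
    (h1 : matInner α β = 0) (h2 : matInner α γ = 0) (h3 : matInner β γ = 0) :
    triple α β γ ^ 2 = -4 * (matInner α α * matInner β β * matInner γ γ) := by
  rw [Matrix.trace_fin_two] at hα hβ hγ
  have key : triple α β γ ^ 2 = -4 * (matInner α α * matInner β β * matInner γ γ
      + 2 * matInner α β * matInner α γ * matInner β γ - matInner α α * matInner β γ ^ 2
      - matInner β β * matInner α γ ^ 2 - matInner γ γ * matInner α β ^ 2) := by
    simp only [triple_eq, matInner_eq, eq_neg_of_add_eq_zero_right hα,
      eq_neg_of_add_eq_zero_right hβ, eq_neg_of_add_eq_zero_right hγ]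
    ring
  rw [key, h1, h2, h3]
  ring

section Diagonal

variable {u : Amb} {θ : ℝ}

/-- The eigenvector `e^{Jθ} u` of `P` has equal components. -/
theorem eq_smul_of_lieP_eq
    (h : lieP u = Real.cos (2 * θ) • u + Real.sin (2 * θ) • lieJ u) :
    let α := (Real.cos θ • u + Real.sin θ • lieJ u).1
    Real.cos θ • u + Real.sin θ • lieJ u = (α, α) ∧
      u = ((Real.cos θ + 1 / √3 * Real.sin θ) • α, (Real.cos θ - 1 / √3 * Real.sin θ) • α) := by
  intro α
  have hc : Real.cos (2 * θ) = 2 * Real.cos θ ^ 2 - 1 := Real.cos_two_mul θ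
  have hs : Real.sin (2 * θ) = 2 * Real.sin θ * Real.cos θ := Real.sin_two_mul θ
  have h1 := Real.sin_sq_add_cos_sq θ
  set w := Real.cos θ • u + Real.sin θ • lieJ u with hw
  have hP : lieP w = w := by
    rw [hw, map_add, map_smul, map_smul, lieP_lieJ, h, map_add, map_smul, map_smul, lieJ_lieJ,
      hc, hs]
    have e2 : 2 * Real.cos θ ^ 2 - 1 = Real.cos θ ^ 2 - Real.sin θ ^ 2 := by linarith
    rw [e2]
    rw [← one_smul ℝ (Real.cos θ • u + Real.sin θ • lieJ u), ← h1]
    module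
  have hwα : w = (α, α) := by
    ext1
    · rfl
    · exact (congrArg Prod.fst hP)
  refine ⟨hwα, ?_⟩
  have hu : u = Real.cos θ • w - Real.sin θ • lieJ w := by
    rw [hw, map_add, map_smul, map_smul, lieJ_lieJ]
    conv_lhs => rw [← one_smul ℝ u, ← h1]
    module
  rw [hwα] at hu
  rw [hu]
  ext1
  · simp only [lieJ, LinearMap.coe_mk, AddHom.coe_mk, Prod.fst_sub, Prod.smul_fst]
    module
  · simp only [lieJ, LinearMap.coe_mk, AddHom.coe_mk, Prod.snd_sub, Prod.smul_snd]
    module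

end Diagonal

theorem bracket_smul_pair (x y x' y' : ℝ) (α β : Mat) :
    bracket (x • α, y • α) (x' • β, y' • β) =
      ((x * x') • (α * β - β * α), (y * y') • (α * β - β * α)) := by
  ext1 <;> simp only [bracket, smul_mul_smul_comm] <;> module

theorem gamma_smul_pair (x y x' y' : ℝ) (α β : Mat) :
    gamma (x • α, y • α) (x' • β, y' • β) =
      ((x * x' / 2 + (y * x' - x * y') / 6) • (α * β - β * α),
        (y * y' / 2 - (y * x' - x * y') / 6) • (α * β - β * α)) := by
  rw [gamma, bracket_smul_pair]
  ext1 <;> simp only [smul_mul_smul_comm, Prod.fst_add, Prod.snd_add, Prod.smul_fst,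
    Prod.smul_snd] <;> module

theorem lieMetric_smul_pair (x y x' y' : ℝ) (α β : Mat) :
    lieMetric (x • α, y • α) (x' • β, y' • β) =
      (2 / 3 * (x * x' + y * y') - 1 / 3 * (y * x' + x * y')) * matInner α β := by
  simp only [lieMetric_apply, nkMetric_one, matInner_eq, Matrix.smul_apply, smul_eq_mul]
  ring

theorem lieJ_smul_pair (x y : ℝ) (α : Mat) :
    lieJ (x • α, y • α) = ((1 / √3 * (x - 2 * y)) • α, (1 / √3 * (2 * x - y)) • α) := by
  ext1 <;> simp only [lieJ, LinearMap.coe_mk, AddHom.coe_mk, Prod.smul_fst, Prod.smul_snd] <;>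
    module

section Trig
variable (A B C : ℝ) (α β γ : Mat)

/-- `e^{-Jθ} (α, α)`: the vectors `u` with `P u = cos 2θ u + sin 2θ J u`. -/
noncomputable def rot (θ : ℝ) (α : Mat) : Amb :=
  ((Real.cos θ + 1 / √3 * Real.sin θ) • α, (Real.cos θ - 1 / √3 * Real.sin θ) • α)

theorem lieJ_rot : lieJ (rot A α) =
    ((Real.sin A - 1 / √3 * Real.cos A) • α, (Real.sin A + 1 / √3 * Real.cos A) • α) := by
  have h := sq_one_div_sqrt_three
  rw [rot, lieJ_smul_pair]
  congr 2 <;> linear_combination (3 * Real.sin A) * h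

theorem lieMetric_bracket_rot :
    lieMetric (bracket (rot A α) (rot B β)) (rot C γ) =
      (4 / 9 * Real.cos (C - (A + B)) - 2 / 9 * Real.cos (C + (A + B))
        + 4 / 9 * Real.cos (A - B) * Real.cos C) * triple α β γ := by
  have h := sq_one_div_sqrt_three
  rw [rot, rot, rot, bracket_smul_pair, lieMetric_smul_pair, triple]
  congr 1
  simp only [Real.cos_sub, Real.cos_add, Real.sin_add]
  generalize Real.cos A = a at *
  generalize Real.cos B = b at *
  generalize Real.cos C = c at *
  generalize Real.sin A = a' at *
  generalize Real.sin B = b' at *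
  generalize Real.sin C = c' at *
  generalize (1 / √3 : ℝ) = r at *
  linear_combination (2 * (a' * b * c' + a * b' * c') + 2 / 3 * a' * b' * c) * h

theorem lieMetric_gamma_rot :
    lieMetric (gamma (rot A α) (rot B β)) (lieJ (rot C γ)) =
      (4 / 9 * Real.sin (C - B) * Real.cos A - 1 / 9 * Real.sin (A + B + C)) * triple α β γ := by
  have h := sq_one_div_sqrt_three
  rw [lieJ_rot, rot, rot, gamma_smul_pair, lieMetric_smul_pair, triple]
  congr 1
  simp only [Real.cos_add, Real.sin_sub, Real.sin_add]
  generalize Real.cos A = a at *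
  generalize Real.cos B = b at *
  generalize Real.cos C = c at *
  generalize Real.sin A = a' at *
  generalize Real.sin B = b' at *
  generalize Real.sin C = c' at *
  generalize (1 / √3 : ℝ) = r at *
  linear_combination (-5 / 3 * a * b' * c - 1 / 3 * a' * b * c + 1 / 3 * a' * b' * c') * h

end Trig

/-! ### First-order data of a diagonalizing frame at a point -/

/-- The first-order data at one point of a diagonalizing frame of a Lagrangian immersion, read in
the left trivialisation: `e i` is the `i`-th frame vector and `d i j` the derivative of the
trivialised field `e j` in the direction of the frame vector `i`; `θ` are the angles, `c' i j` and
`s' i j` the derivatives of `cos 2θⱼ` and `sin 2θⱼ` in that direction, and `t i j` the coefficients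
of the Lie bracket of the frame fields `i` and `j`. -/
structure FrameJet (e : Fin 3 → Amb) (d : Fin 3 → Fin 3 → Amb) (θ : Fin 3 → ℝ)
    (c' s' : Fin 3 → Fin 3 → ℝ) (t : Fin 3 → Fin 3 → Fin 3 → ℝ) : Prop where
  trace_fst : ∀ i, (e i).1.trace = 0
  trace_snd : ∀ i, (e i).2.trace = 0
  orth : ∀ i j, lieMetric (e i) (e j) = delta1 i j
  lagr : ∀ i j, lieMetric (e i) (lieJ (e j)) = 0
  diag : ∀ i, lieP (e i) = Real.cos (2 * θ i) • e i + Real.sin (2 * θ i) • lieJ (e i)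
  deriv_lagr : ∀ k i j, lieMetric (d k i) (lieJ (e j)) + lieMetric (e i) (lieJ (d k j)) = 0
  deriv_diag : ∀ k i, lieP (d k i) =
    (c' k i • e i + Real.cos (2 * θ i) • d k i) +
      (s' k i • lieJ (e i) + Real.sin (2 * θ i) • lieJ (d k i))
  torsion : ∀ i j, d i j - d j i + bracket (e i) (e j) = ∑ k, t i j k • e k

theorem delta1_ne (i j : Fin 3) (h : i ≠ j) : delta1 i j = 0 := Matrix.diagonal_apply_ne _ h

theorem delta1_self_ne_zero (i : Fin 3) : delta1 i i ≠ 0 := by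
  rw [delta1, Matrix.diagonal_apply_eq]
  fin_cases i <;> simp

namespace FrameJet

variable {e : Fin 3 → Amb} {d : Fin 3 → Fin 3 → Amb} {θ : Fin 3 → ℝ}
  {c' s' : Fin 3 → Fin 3 → ℝ} {t : Fin 3 → Fin 3 → Fin 3 → ℝ}

/-- Only the angles `2θᵢ` modulo `2π` matter. -/
theorem congr_angle (H : FrameJet e d θ c' s' t) {θ' : Fin 3 → ℝ}
    (hc : ∀ i, Real.cos (2 * θ' i) = Real.cos (2 * θ i))
    (hs : ∀ i, Real.sin (2 * θ' i) = Real.sin (2 * θ i)) : FrameJet e d θ' c' s' t where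
  __ := H
  diag i := by rw [hc, hs]; exact H.diag i
  deriv_diag k i := by rw [hc, hs]; exact H.deriv_diag k i

/-- The matrix `αᵢ` with `eᵢ = e^{-Jθᵢ} (αᵢ, αᵢ)`. -/
noncomputable def core (e : Fin 3 → Amb) (θ : Fin 3 → ℝ) (i : Fin 3) : Mat :=
  (Real.cos (θ i) • e i + Real.sin (θ i) • lieJ (e i)).1

theorem eq_rot (H : FrameJet e d θ c' s' t) (i : Fin 3) : e i = rot (θ i) (core e θ i) :=
  (eq_smul_of_lieP_eq (H.diag i)).2

theorem core_pair (H : FrameJet e d θ c' s' t) (i : Fin 3) :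
    Real.cos (θ i) • e i + Real.sin (θ i) • lieJ (e i) = (core e θ i, core e θ i) :=
  (eq_smul_of_lieP_eq (H.diag i)).1

theorem core_trace (H : FrameJet e d θ c' s' t) (i : Fin 3) : (core e θ i).trace = 0 := by
  simp [core, lieJ, H.trace_fst, H.trace_snd]

theorem core_inner (H : FrameJet e d θ c' s' t) (i j : Fin 3) :
    matInner (core e θ i) (core e θ j) = 3 / 2 * delta1 i j := by
  have h1 := lieMetric_smul_pair 1 1 1 1 (core e θ i) (core e θ j)
  simp only [one_smul] at h1
  rw [← H.core_pair, ← H.core_pair] at h1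
  simp only [map_add, map_smul, LinearMap.add_apply, LinearMap.smul_apply, smul_eq_mul,
    H.orth, H.lagr, lieMetric_lieJ_left, lieJ_lieJ, map_neg] at h1
  by_cases hij : i = j
  · subst hij
    have h2 := Real.sin_sq_add_cos_sq (θ i)
    linear_combination (-3 / 2) * h1 + 3 / 2 * delta1 i i * h2
  · rw [delta1_ne i j hij] at h1 ⊢
    linear_combination (-3 / 2) * h1

theorem triple_ne_zero (H : FrameJet e d θ c' s' t) {p q r : Fin 3} (hpq : p ≠ q) (hpr : p ≠ r)
    (hqr : q ≠ r) : triple (core e θ p) (core e θ q) (core e θ r) ≠ 0 := by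
  intro h0
  have h := triple_sq (H.core_trace p) (H.core_trace q) (H.core_trace r)
    (by rw [H.core_inner, delta1_ne _ _ hpq, mul_zero])
    (by rw [H.core_inner, delta1_ne _ _ hpr, mul_zero])
    (by rw [H.core_inner, delta1_ne _ _ hqr, mul_zero])
  rw [h0, H.core_inner, H.core_inner, H.core_inner] at h
  have := mul_ne_zero (mul_ne_zero (delta1_self_ne_zero p) (delta1_self_ne_zero q))
    (delta1_self_ne_zero r)
  exact this (by linear_combination (2 / 27) * h)

/-- The normal components `g(dᵢⱼ, J eₖ)` of the derivatives of the frame. -/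
noncomputable def normalPart (e : Fin 3 → Amb) (d : Fin 3 → Fin 3 → Amb) (i j k : Fin 3) : ℝ :=
  lieMetric (d i j) (lieJ (e k))

/-- The second fundamental form `g(∇̃_{eᵢ} eⱼ, J eₖ)`. -/
noncomputable def sff (e : Fin 3 → Amb) (d : Fin 3 → Fin 3 → Amb) (i j k : Fin 3) : ℝ :=
  lieMetric (d i j + gamma (e i) (e j)) (lieJ (e k))

theorem normalPart_symm (H : FrameJet e d θ c' s' t) (i j k : Fin 3) :
    normalPart e d i j k = normalPart e d i k j := by
  have h := H.deriv_lagr i j k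
  rw [lieMetric_symm (e j), lieMetric_lieJ_left] at h
  exact eq_of_sub_eq_zero (by simpa [sub_eq_add_neg, normalPart] using h)

theorem sff_eq (H : FrameJet e d θ c' s' t) (i j k : Fin 3) :
    sff e d i j k = normalPart e d i j k +
      (4 / 9 * Real.sin (θ k - θ j) * Real.cos (θ i) - 1 / 9 * Real.sin (θ i + θ j + θ k)) *
        triple (core e θ i) (core e θ j) (core e θ k) := by
  rw [sff, map_add, LinearMap.add_apply]
  conv_lhs => rw [H.eq_rot i, H.eq_rot j, H.eq_rot k, lieMetric_gamma_rot, ← H.eq_rot k]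
  rfl

theorem sff_swap (H : FrameJet e d θ c' s' t) (i j k : Fin 3) :
    sff e d i j k = sff e d j i k := by
  have h := congrArg (fun v => lieMetric v (lieJ (e k))) (H.torsion i j)
  have h2 : lieMetric (∑ l, t i j l • e l) (lieJ (e k)) = 0 := by
    simp [H.lagr]
  rw [← gamma_torsion_free] at h
  simp only [h2] at h
  rw [sff, sff, ← sub_eq_zero, ← LinearMap.sub_apply, ← map_sub, ← h]
  congr 2
  abel

/-- Because the almost Kähler form vanishes on a Lagrangian immersion together with its exterior
derivative, the angles add up to `0` modulo `π`. -/
theorem sin_angle_sum (H : FrameJet e d θ c' s' t) {p q r : Fin 3} (hpq : p ≠ q) (hpr : p ≠ r)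
    (hqr : q ≠ r) : Real.sin (θ p + θ q + θ r) = 0 := by
  have key : ∀ i j k, sff e d i j k - sff e d i k j =
      -(2 / 9) * Real.sin (θ i + θ j + θ k) *
        triple (core e θ i) (core e θ j) (core e θ k) := by
    intro i j k
    rw [H.sff_eq, H.sff_eq, triple_swap_right (core e θ i) (core e θ j) (core e θ k),
      H.normalPart_symm i j k, show θ i + θ k + θ j = θ i + θ j + θ k by ring,
      ← neg_sub (θ k) (θ j), Real.sin_neg]
    ring
  -- Three exchanges of the last two indices, alternating with three of the first two, return to
  -- the start, so that the defects in `key` cancel.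
  have k1 := key p q r
  have k2 := key r p q
  have k3 := key q r p
  rw [triple_swap_left (core e θ p), triple_swap_right (core e θ p),
    show θ r + θ p + θ q = θ p + θ q + θ r by ring] at k2
  rw [triple_swap_right (core e θ q), triple_swap_left (core e θ p),
    show θ q + θ r + θ p = θ p + θ q + θ r by ring] at k3
  have h1 := H.sff_swap p r q
  have h2 := H.sff_swap r q p
  have h3 := H.sff_swap q p r
  have hT := H.triple_ne_zero hpq hpr hqr
  refine (mul_eq_zero.1 ?_).resolve_right hT
  linear_combination (3 / 2) * (k1 + k2 + k3) + (3 / 2) * (h1 + h2 + h3)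

theorem sff_symm (H : FrameJet e d θ c' s' t) (i j k : Fin 3) :
    sff e d i j k = sff e d i k j := by
  have hT : Real.sin (θ i + θ j + θ k) * triple (core e θ i) (core e θ j) (core e θ k) = 0 := by
    by_cases hij : i = j
    · rw [hij, triple_self_left, mul_zero]
    by_cases hik : i = k
    · rw [hik, triple_self_outer, mul_zero]
    by_cases hjk : j = k
    · rw [hjk, triple_self_right, mul_zero]
    rw [H.sin_angle_sum hij hik hjk, zero_mul]
  rw [H.sff_eq, H.sff_eq, triple_swap_right (core e θ i) (core e θ j) (core e θ k),
    H.normalPart_symm i j k, show θ i + θ k + θ j = θ i + θ j + θ k by ring,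
    ← neg_sub (θ k) (θ j), Real.sin_neg]
  linear_combination (-2 / 9) * hT

/-- The off-diagonal part of the derivative of `P eᵢ = cos 2θᵢ eᵢ + sin 2θᵢ J eᵢ`: the normal and
the tangential part of `d j i` along distinct frame vectors determine each other through the
difference of the angles. -/
theorem normalPart_mul_cos (H : FrameJet e d θ c' s' t) (j : Fin 3) {i k : Fin 3} (hik : i ≠ k) :
    normalPart e d j i k * Real.cos (θ k - θ i) =
      lieMetric (d j i) (e k) * Real.sin (θ k - θ i) := by
  have h1 := congrArg (fun v => lieMetric v (e k)) (H.deriv_diag j i)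
  have h2 := congrArg (fun v => lieMetric v (lieJ (e k))) (H.deriv_diag j i)
  simp only [lieMetric_lieP_left, lieP_lieJ, H.diag, map_add, map_neg, map_smul,
    LinearMap.add_apply, LinearMap.smul_apply, smul_eq_mul, H.orth, H.lagr, lieMetric_lieJ_left,
    lieJ_lieJ, delta1_ne i k hik] at h1 h2
  rw [normalPart]
  set b := lieMetric (d j i) (lieJ (e k))
  set a := lieMetric (d j i) (e k)
  have hi := Real.sin_sq_add_cos_sq (θ i)
  have hk := Real.sin_sq_add_cos_sq (θ k)
  have hsum := Real.sin_sq_add_cos_sq (θ k + θ i)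
  have e1 : Real.cos (2 * θ k) - Real.cos (2 * θ i) =
      -2 * Real.sin (θ k + θ i) * Real.sin (θ k - θ i) := by
    rw [Real.cos_sub_cos]; congr 2 <;> ring_nf
  have e2 : Real.sin (2 * θ k) + Real.sin (2 * θ i) =
      2 * Real.sin (θ k + θ i) * Real.cos (θ k - θ i) := by
    rw [Real.sin_two_mul, Real.sin_two_mul, Real.sin_add, Real.cos_sub]
    linear_combination -2 * Real.sin (θ i) * Real.cos (θ i) * hk -
      2 * Real.sin (θ k) * Real.cos (θ k) * hi
  have e3 : Real.sin (2 * θ k) - Real.sin (2 * θ i) =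
      2 * Real.cos (θ k + θ i) * Real.sin (θ k - θ i) := by
    rw [Real.sin_sub_sin, show (2 * θ k - 2 * θ i) / 2 = θ k - θ i by ring,
      show (2 * θ k + 2 * θ i) / 2 = θ k + θ i by ring]; ring
  have e4 : Real.cos (2 * θ k) + Real.cos (2 * θ i) =
      2 * Real.cos (θ k + θ i) * Real.cos (θ k - θ i) := by
    rw [Real.cos_add_cos, show (2 * θ k - 2 * θ i) / 2 = θ k - θ i by ring,
      show (2 * θ k + 2 * θ i) / 2 = θ k + θ i by ring]
  have f1 : Real.sin (θ k + θ i) * (b * Real.cos (θ k - θ i) - a * Real.sin (θ k - θ i)) = 0 := by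
    linear_combination (1 / 2) * h1 - (1 / 2) * a * e1 - (1 / 2) * b * e2
  have f2 : Real.cos (θ k + θ i) * (b * Real.cos (θ k - θ i) - a * Real.sin (θ k - θ i)) = 0 := by
    linear_combination (-1 / 2) * h2 + (1 / 2) * a * e3 - (1 / 2) * b * e4
  linear_combination Real.sin (θ k + θ i) * f1 + Real.cos (θ k + θ i) * f2 -
    (b * Real.cos (θ k - θ i) - a * Real.sin (θ k - θ i)) * hsum

/-- The diagonal part of the derivative of `P eᵢ = cos 2θᵢ eᵢ + sin 2θᵢ J eᵢ`: the second
fundamental form determines the derivatives of the angles. -/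
theorem deriv_angle (H : FrameJet e d θ c' s' t) (j i : Fin 3) :
    c' j i * delta1 i i = 2 * Real.sin (2 * θ i) * sff e d j i i ∧
      s' j i * delta1 i i = -2 * Real.cos (2 * θ i) * sff e d j i i := by
  have h1 := congrArg (fun v => lieMetric v (e i)) (H.deriv_diag j i)
  have h2 := congrArg (fun v => lieMetric v (lieJ (e i))) (H.deriv_diag j i)
  simp only [lieMetric_lieP_left, lieP_lieJ, H.diag, map_add, map_neg, map_smul,
    LinearMap.add_apply, LinearMap.smul_apply, smul_eq_mul, H.orth, H.lagr, lieMetric_lieJ_left,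
    lieJ_lieJ] at h1 h2
  rw [H.sff_eq, triple_self_right, mul_zero, add_zero, normalPart]
  constructor
  · linear_combination -h1
  · linear_combination -h2

end FrameJet

/-! ### Two equal angles force the second fundamental form to vanish -/

namespace FrameJet

variable {e : Fin 3 → Amb} {d : Fin 3 → Fin 3 → Amb} {θ : Fin 3 → ℝ}
  {c' s' : Fin 3 → Fin 3 → ℝ} {t : Fin 3 → Fin 3 → Fin 3 → ℝ}

/-- If two angles agree, the third one is minus their sum modulo `π`, so that its double angle is
determined. -/
theorem third_angle (H : FrameJet e d θ c' s' t) {p q r : Fin 3} (hpq : p ≠ q) (hpr : p ≠ r)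
    (hqr : q ≠ r) (hθ : θ q = θ p) :
    Real.cos (2 * θ r) = 2 * Real.cos (2 * θ p) ^ 2 - 1 ∧
      Real.sin (2 * θ r) = -2 * Real.sin (2 * θ p) * Real.cos (2 * θ p) := by
  have h := H.sin_angle_sum hpq hpr hqr
  rw [hθ] at h
  have hc : Real.cos (2 * (θ p + θ p + θ r)) = 1 := by
    have := Real.sin_sq_add_cos_sq (θ p + θ p + θ r)
    rw [Real.cos_two_mul]
    rw [h] at this
    linarith
  have hs : Real.sin (2 * (θ p + θ p + θ r)) = 0 := by
    rw [Real.sin_two_mul, h]; ring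
  have e1 : 2 * θ r = 2 * (θ p + θ p + θ r) - 2 * (2 * θ p) := by ring
  rw [e1, Real.cos_sub, Real.sin_sub, hc, hs, Real.cos_two_mul (2 * θ p),
    Real.sin_two_mul (2 * θ p)]
  constructor <;> ring

/-- If `c = cos 2θ` and `s = sin 2θ`, then `c x = s x = 0` forces `x = 0`. -/
theorem eq_zero_of_cos_mul_of_sin_mul {φ x : ℝ} (hs : Real.sin φ * x = 0)
    (hc : Real.cos φ * x = 0) : x = 0 := by
  linear_combination Real.sin φ * hs + Real.cos φ * hc - x * Real.sin_sq_add_cos_sq φ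

theorem sff_eq_zero_of_angle_eq (H : FrameJet e d θ c' s' t) {p q : Fin 3} (hpq : p ≠ q)
    (hθ : θ q = θ p) (j : Fin 3) : sff e d j p q = 0 := by
  have h := H.normalPart_mul_cos j hpq
  rw [hθ, sub_self, Real.cos_zero, Real.sin_zero, mul_zero, mul_one] at h
  rw [H.sff_eq, h, hθ, sub_self, Real.sin_zero]
  by_cases hjp : j = p
  · rw [hjp, triple_self_left]; ring
  by_cases hjq : j = q
  · rw [hjq, triple_self_outer]; ring
  have := H.sin_angle_sum hjp hjq hpq
  rw [hθ] at this
  rw [this]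
  ring

/-- The derivatives of two equal angles agree. -/
theorem sff_diag_of_deriv_eq (H : FrameJet e d θ c' s' t) {p q : Fin 3} (hθ : θ q = θ p)
    {j : Fin 3} (hc : c' j q = c' j p) (hs : s' j q = s' j p) :
    sff e d j q q * delta1 p p = sff e d j p p * delta1 q q := by
  obtain ⟨h1, h2⟩ := H.deriv_angle j p
  obtain ⟨h3, h4⟩ := H.deriv_angle j q
  rw [hθ, hc] at h3
  rw [hθ, hs] at h4
  refine sub_eq_zero.1 (eq_zero_of_cos_mul_of_sin_mul (φ := 2 * θ p) ?_ ?_)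
  · linear_combination (1 / 2) * delta1 q q * h1 - (1 / 2) * delta1 p p * h3
  · linear_combination (-1 / 2) * delta1 q q * h2 + (1 / 2) * delta1 p p * h4

/-- The derivative of the third angle is `-2` times the derivative of the common angle. -/
theorem sff_diag_third (H : FrameJet e d θ c' s' t) {p q r : Fin 3} (hpq : p ≠ q) (hpr : p ≠ r)
    (hqr : q ≠ r) (hθ : θ q = θ p) {j : Fin 3}
    (hc : c' j r = 4 * Real.cos (2 * θ p) * c' j p)
    (hs : s' j r = -2 * (s' j p * Real.cos (2 * θ p) + Real.sin (2 * θ p) * c' j p)) :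
    sff e d j r r * delta1 p p = -2 * sff e d j p p * delta1 r r := by
  obtain ⟨h1, h2⟩ := H.deriv_angle j p
  obtain ⟨h3, h4⟩ := H.deriv_angle j r
  obtain ⟨k1, k2⟩ := H.third_angle hpq hpr hqr hθ
  rw [hc] at h3
  rw [hs] at h4
  have hone := Real.sin_sq_add_cos_sq (2 * θ p)
  refine sub_eq_zero.1 (eq_zero_of_cos_mul_of_sin_mul (φ := 2 * θ r) ?_ ?_)
  · rw [k2] at h3 ⊢
    linear_combination (-1 / 2) * delta1 p p * h3 +
      2 * Real.cos (2 * θ p) * delta1 r r * h1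
  · rw [k1] at h4 ⊢
    linear_combination (1 / 2) * delta1 p p * h4 +
      Real.cos (2 * θ p) * delta1 r r * h2 + Real.sin (2 * θ p) * delta1 r r * h1
      + 2 * sff e d j p p * delta1 r r * hone

/-- If the third angle differs from the common one modulo `π` and the second fundamental form has
no component of type `(p, q, r)`, then the bracket of the frame fields `p` and `q` has a nonzero
component along the frame field `r`. -/
theorem bracket_coeff_ne_zero (H : FrameJet e d θ c' s' t) {p q r : Fin 3} (hpq : p ≠ q)
    (hpr : p ≠ r) (hqr : q ≠ r) (hθ : θ q = θ p) (hsin : Real.sin (θ r - θ p) ≠ 0)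
    (h0 : sff e d p q r = 0) (h1 : sff e d q p r = 0) : t p q r ≠ 0 := by
  intro ht
  have hS := H.sin_angle_sum hpq hpr hqr
  have hS' : Real.sin (θ q + θ p + θ r) = 0 := by rwa [add_comm (θ q)]
  have n1 := H.normalPart_mul_cos p hqr
  have n2 := H.normalPart_mul_cos q hpr
  rw [H.sff_eq, hS] at h0
  rw [H.sff_eq, hS', triple_swap_left (core e θ p)] at h1
  have htor := congrArg (fun v => lieMetric v (e r)) (H.torsion p q)
  have e1 : lieMetric (∑ l, t p q l • e l) (e r) = t p q r * delta1 r r := by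
    rw [map_sum, LinearMap.sum_apply, Finset.sum_eq_single r]
    · rw [map_smul, LinearMap.smul_apply, H.orth, smul_eq_mul]
    · intro l _ hl
      rw [map_smul, LinearMap.smul_apply, H.orth, delta1_ne _ _ hl, smul_zero]
    · simp
  have e2 : lieMetric (bracket (e p) (e q)) (e r) =
      (4 / 9 * Real.cos (θ r - (θ p + θ q)) - 2 / 9 * Real.cos (θ r + (θ p + θ q))
        + 4 / 9 * Real.cos (θ p - θ q) * Real.cos (θ r)) *
        triple (core e θ p) (core e θ q) (core e θ r) := by
    conv_lhs => rw [H.eq_rot p, H.eq_rot q, H.eq_rot r]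
    exact lieMetric_bracket_rot _ _ _ _ _ _
  simp only [map_add, map_sub, LinearMap.add_apply, LinearMap.sub_apply, e2, e1, ht] at htor
  rw [hθ] at n1 htor hS h0
  rw [hθ] at h1
  set T := triple (core e θ p) (core e θ q) (core e θ r)
  have hT : T ≠ 0 := H.triple_ne_zero hpq hpr hqr
  have m1 : lieMetric (d p q) (e r) = -(4 / 9) * Real.cos (θ r - θ p) * Real.cos (θ p) * T := by
    apply mul_right_cancel₀ hsin
    linear_combination -n1 + Real.cos (θ r - θ p) * h0
  have m2 : lieMetric (d q p) (e r) = 4 / 9 * Real.cos (θ r - θ p) * Real.cos (θ p) * T := by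
    apply mul_right_cancel₀ hsin
    linear_combination -n2 + Real.cos (θ r - θ p) * h1
  have c1 : Real.cos (θ r - (θ p + θ p)) =
      2 * Real.cos (θ r - θ p) * Real.cos (θ p) - Real.cos (θ r) := by
    have a1 := Real.cos_add (θ r - θ p) (θ p)
    have a2 := Real.cos_sub (θ r - θ p) (θ p)
    rw [sub_add_cancel] at a1
    rw [← sub_sub]
    linarith
  rw [m1, m2, c1, sub_self, Real.cos_zero] at htor
  have hC : Real.cos (θ r + (θ p + θ p)) = 0 := by
    refine (mul_eq_zero.1 ?_).resolve_right hT
    linear_combination (-9 / 2) * htor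
  have := Real.sin_sq_add_cos_sq (θ r + (θ p + θ p))
  rw [hC, add_comm (θ r), hS] at this
  norm_num at this

theorem eq_or_eq_or_eq_of_ne : ∀ {p q r : Fin 3}, p ≠ q → p ≠ r → q ≠ r →
    ∀ j : Fin 3, j = p ∨ j = q ∨ j = r := by
  decide

section Coincident

variable {p q r : Fin 3}

/-- The constancy of the common angle in the directions of the two frame fields with this angle. -/
theorem deriv_eq_zero (H : FrameJet e d θ c' s' t) (hpq : p ≠ q) (hθ : θ q = θ p)
    (hcq : ∀ j, c' j q = c' j p) (hsq : ∀ j, s' j q = s' j p) :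
    (sff e d p p p = 0 ∧ sff e d q p p = 0) ∧
      (c' p p = 0 ∧ s' p p = 0) ∧ c' q p = 0 ∧ s' q p = 0 := by
  have hz := H.sff_eq_zero_of_angle_eq hpq hθ
  have a1 : sff e d p p p = 0 := by
    have := H.sff_diag_of_deriv_eq hθ (hcq p) (hsq p)
    rw [H.sff_swap p q q, hz, zero_mul] at this
    exact (mul_eq_zero.1 this.symm).resolve_right (delta1_self_ne_zero q)
  have a2 : sff e d q p p = 0 := by
    rw [H.sff_swap, H.sff_symm]; exact hz p
  have b := H.deriv_angle p p
  have b' := H.deriv_angle q p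
  rw [a1, mul_zero, mul_zero] at b
  rw [a2, mul_zero, mul_zero] at b'
  have hδ := delta1_self_ne_zero p
  exact ⟨⟨a1, a2⟩, ⟨(mul_eq_zero.1 b.1).resolve_right hδ, (mul_eq_zero.1 b.2).resolve_right hδ⟩,
    (mul_eq_zero.1 b'.1).resolve_right hδ, (mul_eq_zero.1 b'.2).resolve_right hδ⟩

/-- The common angle is stationary also in the third direction: its derivative kills the bracket of
the other two frame fields. -/
theorem sff_third_eq_zero (H : FrameJet e d θ c' s' t) (hpq : p ≠ q) (hpr : p ≠ r) (hqr : q ≠ r)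
    (hθ : θ q = θ p) (hcq : ∀ j, c' j q = c' j p) (hsq : ∀ j, s' j q = s' j p)
    (htc : ∑ k, t p q k * c' k p = 0) (hts : ∑ k, t p q k * s' k p = 0) :
    sff e d r p p = 0 := by
  obtain ⟨-, ⟨z1, z2⟩, z3, z4⟩ := H.deriv_eq_zero hpq hθ hcq hsq
  have hsum : ∀ w : Fin 3 → ℝ, w p = 0 → w q = 0 → ∑ k, w k = w r := by
    intro w hp hq
    refine Finset.sum_eq_single r (fun b _ hb => ?_) (by simp)
    rcases eq_or_eq_or_eq_of_ne hpq hpr hqr b with rfl | rfl | rfl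
    exacts [hp, hq, absurd rfl hb]
  rw [hsum _ (by rw [z1, mul_zero]) (by rw [z3, mul_zero])] at htc
  rw [hsum _ (by rw [z2, mul_zero]) (by rw [z4, mul_zero])] at hts
  by_cases hsin : Real.sin (θ r - θ p) = 0
  · have h := H.normalPart_mul_cos p hpr
    rw [hsin, mul_zero] at h
    have hcos : Real.cos (θ r - θ p) ≠ 0 := by
      intro h0
      have := Real.sin_sq_add_cos_sq (θ r - θ p)
      rw [h0, hsin] at this
      norm_num at this
    rw [H.sff_swap, H.sff_symm, H.sff_eq, triple_self_left, mul_zero, add_zero]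
    exact (mul_eq_zero.1 h).resolve_right hcos
  · have hz := H.sff_eq_zero_of_angle_eq hpq hθ r
    have ht : t p q r ≠ 0 := H.bracket_coeff_ne_zero hpq hpr hqr hθ hsin
      (by rw [H.sff_symm, H.sff_swap]; exact hz)
      (by rw [H.sff_symm, H.sff_swap, H.sff_symm]; exact hz)
    have hδ := delta1_self_ne_zero p
    have h := H.deriv_angle r p
    rw [(mul_eq_zero.1 htc).resolve_left ht, (mul_eq_zero.1 hts).resolve_left ht] at h
    refine eq_zero_of_cos_mul_of_sin_mul (φ := 2 * θ p) ?_ ?_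
    · linear_combination (-1 / 2) * h.1
    · linear_combination (1 / 2) * h.2

/-- The pointwise core of the argument: two equal angles, with the resulting relations between the
derivatives of the three angles, and the vanishing of the derivative of the common angle along the
bracket of its two frame fields, force the second fundamental form to vanish. -/
theorem sff_eq_zero (H : FrameJet e d θ c' s' t) (hpq : p ≠ q) (hpr : p ≠ r) (hqr : q ≠ r)
    (hθ : θ q = θ p) (hcq : ∀ j, c' j q = c' j p) (hsq : ∀ j, s' j q = s' j p)
    (hcr : ∀ j, c' j r = 4 * Real.cos (2 * θ p) * c' j p)
    (hsr : ∀ j, s' j r = -2 * (s' j p * Real.cos (2 * θ p) + Real.sin (2 * θ p) * c' j p))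
    (htc : ∑ k, t p q k * c' k p = 0) (hts : ∑ k, t p q k * s' k p = 0) (i j k : Fin 3) :
    sff e d i j k = 0 := by
  obtain ⟨⟨zp, zq⟩, -⟩ := H.deriv_eq_zero hpq hθ hcq hsq
  have zr := H.sff_third_eq_zero hpq hpr hqr hθ hcq hsq htc hts
  have hcover := eq_or_eq_or_eq_of_ne hpq hpr hqr
  have zz := H.sff_eq_zero_of_angle_eq hpq hθ
  have fp : ∀ j, sff e d j p p = 0 := by
    intro j
    rcases hcover j with rfl | rfl | rfl
    exacts [zp, zq, zr]
  have fq : ∀ j, sff e d j q q = 0 := by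
    intro j
    have := H.sff_diag_of_deriv_eq hθ (hcq j) (hsq j)
    rw [fp, zero_mul] at this
    exact (mul_eq_zero.1 this).resolve_right (delta1_self_ne_zero p)
  have fr : ∀ j, sff e d j r r = 0 := by
    intro j
    have := H.sff_diag_third hpq hpr hqr hθ (hcr j) (hsr j)
    rw [fp, mul_zero, zero_mul] at this
    exact (mul_eq_zero.1 this).resolve_right (delta1_self_ne_zero p)
  have hd : ∀ i j, sff e d i j j = 0 := by
    intro i j
    rcases hcover j with rfl | rfl | rfl
    exacts [fp i, fq i, fr i]
  have key : ∀ i, sff e d i p q = 0 ∧ sff e d i q r = 0 ∧ sff e d i p r = 0 := by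
    intro i
    refine ⟨zz i, ?_, ?_⟩
    · rcases hcover i with rfl | rfl | rfl
      · rw [H.sff_symm, H.sff_swap]; exact zz _
      · rw [H.sff_symm, H.sff_swap]; exact hd _ _
      · rw [H.sff_swap]; exact hd _ _
    · rcases hcover i with rfl | rfl | rfl
      · rw [H.sff_symm, H.sff_swap]; exact hd _ _
      · rw [H.sff_symm, H.sff_swap, H.sff_symm]; exact zz _
      · rw [H.sff_swap]; exact hd _ _
  by_cases hjk : j = k
  · rw [hjk]; exact hd _ _
  rcases hcover j with rfl | rfl | rfl <;> rcases hcover k with rfl | rfl | rfl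
  exacts [absurd rfl hjk, (key i).1, (key i).2.2,
    (H.sff_symm _ _ _).trans (key i).1, absurd rfl hjk, (key i).2.1,
    (H.sff_symm _ _ _).trans (key i).2.2, (H.sff_symm _ _ _).trans (key i).2.1, absurd rfl hjk]

end Coincident
end FrameJet

/-! ### Product rules for maps into the matrix space -/

section Products

variable {M : Type*} [TopologicalSpace M] [ChartedSpace (EuclideanSpace ℝ (Fin 3)) M]
  {N N₁ N₂ : Type*} [NormedAddCommGroup N] [NormedSpace ℝ N]
  [NormedAddCommGroup N₁] [NormedSpace ℝ N₁] [NormedAddCommGroup N₂] [NormedSpace ℝ N₂]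
  {U : Set M} {q : M}

theorem dirDeriv_congr {G H : M → N} (hU : IsOpen U) (hq : q ∈ U) (h : ∀ x ∈ U, G x = H x)
    (v : TangentSpace (𝓡 3) q) : dirDeriv G q v = dirDeriv H q v := by
  have hev : G =ᶠ[nhds q] H := by
    filter_upwards [hU.mem_nhds hq] with x hx using h x hx
  by_cases hG : MDifferentiableAt (𝓡 3) 𝓘(ℝ, N) G q
  · have hH := hG.congr_of_eventuallyEq hev.symm
    rw [dirDeriv_eq_fderiv_center hG, dirDeriv_eq_fderiv_center hH]
    have hc : Filter.Tendsto (extChartAt (𝓡 3) q).symm (nhds (extChartAt (𝓡 3) q q)) (nhds q) := by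
      have := continuousAt_extChartAt_symm (I := 𝓡 3) q
      rwa [ContinuousAt, extChartAt_to_inv] at this
    rw [(hev.comp_tendsto hc).fderiv_eq]
  · have hH : ¬ MDifferentiableAt (𝓡 3) 𝓘(ℝ, N) H q := fun hH =>
      hG (hH.congr_of_eventuallyEq hev)
    rw [dirDeriv, dirDeriv]
    have e1 := mfderiv_zero_of_not_mdifferentiableAt hG
    have e2 := mfderiv_zero_of_not_mdifferentiableAt hH
    exact (DFunLike.congr_fun e1 v).trans (DFunLike.congr_fun e2 v).symm

theorem dirDeriv_const (c : N) (v : TangentSpace (𝓡 3) q) :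
    dirDeriv (fun _ : M => c) q v = 0 := by
  rw [dirDeriv_eq_fderiv_center mdifferentiableAt_const]
  have : ((fun _ : M => c) ∘ (extChartAt (𝓡 3) q).symm) = fun _ => c := rfl
  rw [this, fderiv_fun_const]
  rfl

variable [IsManifold (𝓡 3) ∞ M]

theorem hasFDerivAt_chart {G : M → N} (hU : IsOpen U) (hq : q ∈ U)
    (hG : ContMDiffOn (𝓡 3) 𝓘(ℝ, N) ∞ G U) :
    ∃ L : EuclideanSpace ℝ (Fin 3) →L[ℝ] N,
      HasFDerivAt (G ∘ (extChartAt (𝓡 3) q).symm) L (extChartAt (𝓡 3) q q) ∧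
        ∀ v : TangentSpace (𝓡 3) q, dirDeriv G q v = L v :=
  ⟨_, ((contDiffAt_comp_chart hU hq hG).differentiableAt (by simp)).hasFDerivAt,
    dirDeriv_eq_fderiv_center ((hG.contMDiffAt (hU.mem_nhds hq)).mdifferentiableAt (by simp))⟩

theorem dirDeriv_eq_of_hasFDerivAt {G : M → N} (hU : IsOpen U) (hq : q ∈ U)
    (hG : ContMDiffOn (𝓡 3) 𝓘(ℝ, N) ∞ G U) {L : EuclideanSpace ℝ (Fin 3) →L[ℝ] N}
    (hL : HasFDerivAt (G ∘ (extChartAt (𝓡 3) q).symm) L (extChartAt (𝓡 3) q q))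
    (v : TangentSpace (𝓡 3) q) : dirDeriv G q v = L v := by
  obtain ⟨L', h1, h2⟩ := hasFDerivAt_chart hU hq hG
  rw [h2, h1.unique hL]

omit [IsManifold (𝓡 3) ∞ M] in
theorem contMDiffOn_bilin (B : N₁ →L[ℝ] N₂ →L[ℝ] N) {G : M → N₁} {H : M → N₂}
    (hG : ContMDiffOn (𝓡 3) 𝓘(ℝ, N₁) ∞ G U) (hH : ContMDiffOn (𝓡 3) 𝓘(ℝ, N₂) ∞ H U) :
    ContMDiffOn (𝓡 3) 𝓘(ℝ, N) ∞ (fun x => B (G x) (H x)) U :=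
  ContMDiffOn.clm_apply (B.contMDiff.comp_contMDiffOn hG) hH

theorem dirDeriv_bilin (B : N₁ →L[ℝ] N₂ →L[ℝ] N) {G : M → N₁} {H : M → N₂}
    (hU : IsOpen U) (hq : q ∈ U)
    (hG : ContMDiffOn (𝓡 3) 𝓘(ℝ, N₁) ∞ G U) (hH : ContMDiffOn (𝓡 3) 𝓘(ℝ, N₂) ∞ H U)
    (v : TangentSpace (𝓡 3) q) :
    dirDeriv (fun x => B (G x) (H x)) q v =
      B (dirDeriv G q v) (H q) + B (G q) (dirDeriv H q v) := by
  obtain ⟨L₁, h1, e1⟩ := hasFDerivAt_chart hU hq hG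
  obtain ⟨L₂, h2, e2⟩ := hasFDerivAt_chart hU hq hH
  have h3 := (B.hasFDerivAt.comp _ h1).clm_apply h2
  rw [dirDeriv_eq_of_hasFDerivAt hU hq (contMDiffOn_bilin B hG hH) h3, e1, e2]
  simp only [Function.comp, extChartAt_to_inv]
  exact add_comm _ _

theorem dirDeriv_linear (B : N₁ →L[ℝ] N) {G : M → N₁} (hU : IsOpen U) (hq : q ∈ U)
    (hG : ContMDiffOn (𝓡 3) 𝓘(ℝ, N₁) ∞ G U) (v : TangentSpace (𝓡 3) q) :
    dirDeriv (fun x => B (G x)) q v = B (dirDeriv G q v) := by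
  obtain ⟨L₁, h1, e1⟩ := hasFDerivAt_chart hU hq hG
  have h3 := B.hasFDerivAt.comp _ h1
  rw [e1]
  exact dirDeriv_eq_of_hasFDerivAt hU hq (B.contMDiff.comp_contMDiffOn hG) h3 v

theorem dirDeriv_add {G H : M → N} (hU : IsOpen U) (hq : q ∈ U)
    (hG : ContMDiffOn (𝓡 3) 𝓘(ℝ, N) ∞ G U) (hH : ContMDiffOn (𝓡 3) 𝓘(ℝ, N) ∞ H U)
    (v : TangentSpace (𝓡 3) q) :
    dirDeriv (fun x => G x + H x) q v = dirDeriv G q v + dirDeriv H q v := by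
  obtain ⟨L₁, h1, e1⟩ := hasFDerivAt_chart hU hq hG
  obtain ⟨L₂, h2, e2⟩ := hasFDerivAt_chart hU hq hH
  have h3 := h1.add h2
  rw [e1, e2]
  exact dirDeriv_eq_of_hasFDerivAt hU hq (hG.add hH) h3 v

theorem dirDeriv_mul {G H : M → ℝ} (hU : IsOpen U) (hq : q ∈ U)
    (hG : ContMDiffOn (𝓡 3) 𝓘(ℝ, ℝ) ∞ G U) (hH : ContMDiffOn (𝓡 3) 𝓘(ℝ, ℝ) ∞ H U)
    (v : TangentSpace (𝓡 3) q) :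
    dirDeriv (fun x => G x * H x) q v = dirDeriv G q v * H q + G q * dirDeriv H q v :=
  dirDeriv_bilin (ContinuousLinearMap.mul ℝ ℝ) hU hq hG hH v

end Products

section AmbProducts

variable {M : Type*} [TopologicalSpace M] [ChartedSpace (EuclideanSpace ℝ (Fin 3)) M]
  {N : Type*} [NormedAddCommGroup N] [NormedSpace ℝ N]
  {U : Set M} {q : M}

/-- Smoothness on `U` of a map into `M(2,ℝ) × M(2,ℝ)`. -/
def AmbSmoothOn (G : M → Amb) (U : Set M) : Prop :=
  ContMDiffOn (𝓡 3) 𝓘(ℝ, Euc) ∞ (fun x => toEuc (G x)) U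

theorem toEuc_ambDeriv (G : M → Amb) (v : TangentSpace (𝓡 3) q) :
    toEuc (ambDeriv G q v) = dirDeriv (fun x => toEuc (G x)) q v :=
  toEuc.apply_symm_apply _

/-- A linear map on `M(2,ℝ) × M(2,ℝ)` as a continuous linear map on `ℝ⁸`. -/
noncomputable def eucLinear (L : Amb →ₗ[ℝ] N) : Euc →L[ℝ] N :=
  LinearMap.toContinuousLinearMap (L ∘ₗ toEuc.symm.toLinearMap)

theorem eucLinear_apply (L : Amb →ₗ[ℝ] N) (u : Amb) : eucLinear L (toEuc u) = L u := by
  simp [eucLinear]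

/-- A bilinear map on `M(2,ℝ) × M(2,ℝ)` as a continuous bilinear map on `ℝ⁸`. -/
noncomputable def eucBilin (B : Amb →ₗ[ℝ] Amb →ₗ[ℝ] N) : Euc →L[ℝ] Euc →L[ℝ] N :=
  LinearMap.toContinuousLinearMap
    ((LinearMap.toContinuousLinearMap (𝕜 := ℝ) (E := Euc) (F' := N)).toLinearMap ∘ₗ
      B.compl₁₂ toEuc.symm.toLinearMap toEuc.symm.toLinearMap)

theorem eucBilin_apply (B : Amb →ₗ[ℝ] Amb →ₗ[ℝ] N) (u v : Amb) :
    eucBilin B (toEuc u) (toEuc v) = B u v := by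
  simp [eucBilin]

variable [IsManifold (𝓡 3) ∞ M]

omit [IsManifold (𝓡 3) ∞ M] in
theorem AmbSmoothOn.linear {G : M → Amb} (hG : AmbSmoothOn G U) (L : Amb →ₗ[ℝ] N) :
    ContMDiffOn (𝓡 3) 𝓘(ℝ, N) ∞ (fun x => L (G x)) U := by
  have := (eucLinear L).contMDiff.comp_contMDiffOn hG
  simpa [Function.comp_def, eucLinear_apply] using this

theorem AmbSmoothOn.dirDeriv_linear {G : M → Amb} (hG : AmbSmoothOn G U) (hU : IsOpen U)
    (hq : q ∈ U) (L : Amb →ₗ[ℝ] N) (v : TangentSpace (𝓡 3) q) :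
    dirDeriv (fun x => L (G x)) q v = L (ambDeriv G q v) := by
  have := NKSL2.dirDeriv_linear (eucLinear L) hU hq hG v
  rwa [← toEuc_ambDeriv, eucLinear_apply, funext fun x => eucLinear_apply L (G x)] at this

omit [IsManifold (𝓡 3) ∞ M] in
theorem AmbSmoothOn.bilin {G H : M → Amb} (hG : AmbSmoothOn G U) (hH : AmbSmoothOn H U)
    (B : Amb →ₗ[ℝ] Amb →ₗ[ℝ] N) :
    ContMDiffOn (𝓡 3) 𝓘(ℝ, N) ∞ (fun x => B (G x) (H x)) U := by
  have := contMDiffOn_bilin (eucBilin B) hG hH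
  simpa only [eucBilin_apply] using this

theorem AmbSmoothOn.dirDeriv_bilin {G H : M → Amb} (hG : AmbSmoothOn G U) (hH : AmbSmoothOn H U)
    (hU : IsOpen U) (hq : q ∈ U) (B : Amb →ₗ[ℝ] Amb →ₗ[ℝ] N) (v : TangentSpace (𝓡 3) q) :
    dirDeriv (fun x => B (G x) (H x)) q v =
      B (ambDeriv G q v) (H q) + B (G q) (ambDeriv H q v) := by
  have := NKSL2.dirDeriv_bilin (eucBilin B) hU hq hG hH v
  simpa only [← toEuc_ambDeriv, eucBilin_apply] using this

theorem AmbSmoothOn.ambDeriv_linear {G : M → Amb} (hG : AmbSmoothOn G U) (hU : IsOpen U)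
    (hq : q ∈ U) (L : Amb →ₗ[ℝ] Amb) (v : TangentSpace (𝓡 3) q) :
    ambDeriv (fun x => L (G x)) q v = L (ambDeriv G q v) :=
  toEuc.injective <| (toEuc_ambDeriv _ v).trans
    (hG.dirDeriv_linear hU hq (toEuc.toLinearMap ∘ₗ L) v)

theorem AmbSmoothOn.ambDeriv_bilin {G H : M → Amb} (hG : AmbSmoothOn G U) (hH : AmbSmoothOn H U)
    (hU : IsOpen U) (hq : q ∈ U) (B : Amb →ₗ[ℝ] Amb →ₗ[ℝ] Amb) (v : TangentSpace (𝓡 3) q) :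
    ambDeriv (fun x => B (G x) (H x)) q v =
      B (ambDeriv G q v) (H q) + B (G q) (ambDeriv H q v) := by
  apply toEuc.injective
  rw [map_add]
  exact (toEuc_ambDeriv _ v).trans (hG.dirDeriv_bilin hH hU hq (B.compr₂ toEuc.toLinearMap) v)

omit [IsManifold (𝓡 3) ∞ M] in
theorem AmbSmoothOn.smul {c : M → ℝ} {G : M → Amb} (hc : ContMDiffOn (𝓡 3) 𝓘(ℝ, ℝ) ∞ c U)
    (hG : AmbSmoothOn G U) : AmbSmoothOn (fun x => c x • G x) U := by
  have : ContMDiffOn (𝓡 3) 𝓘(ℝ, Euc) ∞ (fun x => c x • toEuc (G x)) U := ContMDiffOn.smul hc hG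
  simpa only [AmbSmoothOn, map_smul] using this

theorem AmbSmoothOn.ambDeriv_smul {c : M → ℝ} {G : M → Amb}
    (hc : ContMDiffOn (𝓡 3) 𝓘(ℝ, ℝ) ∞ c U) (hG : AmbSmoothOn G U)
    (hU : IsOpen U) (hq : q ∈ U) (v : TangentSpace (𝓡 3) q) :
    ambDeriv (fun x => c x • G x) q v = dirDeriv c q v • G q + c q • ambDeriv G q v := by
  apply toEuc.injective
  have := NKSL2.dirDeriv_bilin (ContinuousLinearMap.lsmul ℝ ℝ) hU hq hc hG v
  rw [toEuc_ambDeriv, map_add, map_smul, map_smul, toEuc_ambDeriv]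
  simp only [map_smul]
  exact this

theorem AmbSmoothOn.ambDeriv_add {G H : M → Amb} (hG : AmbSmoothOn G U) (hH : AmbSmoothOn H U)
    (hU : IsOpen U) (hq : q ∈ U) (v : TangentSpace (𝓡 3) q) :
    ambDeriv (fun x => G x + H x) q v = ambDeriv G q v + ambDeriv H q v := by
  apply toEuc.injective
  have := NKSL2.dirDeriv_add hU hq hG hH v
  rw [map_add, toEuc_ambDeriv, toEuc_ambDeriv, toEuc_ambDeriv, ← this]
  simp only [map_add]

omit [IsManifold (𝓡 3) ∞ M] in
theorem ambDeriv_congr {G H : M → Amb} (hU : IsOpen U) (hq : q ∈ U) (h : ∀ x ∈ U, G x = H x)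
    (v : TangentSpace (𝓡 3) q) : ambDeriv G q v = ambDeriv H q v := by
  apply toEuc.injective
  rw [toEuc_ambDeriv, toEuc_ambDeriv]
  exact dirDeriv_congr hU hq (fun x hx => by rw [h x hx]) v

end AmbProducts

/-! ### Fields along a Lagrangian immersion in the left trivialisation -/

section LeftTriv

theorem leftTriv_add (p : SLSL) (X Y : Amb) : leftTriv p (X + Y) = leftTriv p X + leftTriv p Y := by
  ext1 <;> simp [leftTriv, leftMul, mul_add]

theorem leftTriv_smul (p : SLSL) (c : ℝ) (X : Amb) : leftTriv p (c • X) = c • leftTriv p X := by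
  ext1 <;> simp [leftTriv, leftMul]

theorem nkMetric_eq (p : SLSL) (X Y : Amb) :
    nkMetric p X Y = lieMetric (leftTriv p X) (leftTriv p Y) := by
  conv_lhs => rw [← leftMul_leftTriv p X, ← leftMul_leftTriv p Y, nkMetric_leftMul]
  rfl

theorem leftTriv_almostCpx (p : SLSL) (X : Amb) :
    leftTriv p (almostCpx p X) = lieJ (leftTriv p X) := by
  rw [almostCpx, leftTriv_smul, leftTriv_leftMul]
  rfl

theorem leftTriv_almostProd (p : SLSL) (X : Amb) :
    leftTriv p (almostProd p X) = lieP (leftTriv p X) := by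
  rw [almostProd, leftTriv_leftMul]
  rfl

theorem adjugate_add_fin_two (a b : Mat) : (a + b).adjugate = a.adjugate + b.adjugate := by
  rw [Matrix.adjugate_fin_two, Matrix.adjugate_fin_two, Matrix.adjugate_fin_two]
  ext i j
  fin_cases i <;> fin_cases j <;> simp [add_comm]

theorem adjugate_smul_fin_two (c : ℝ) (a : Mat) : (c • a).adjugate = c • a.adjugate := by
  simp [Matrix.adjugate_smul]

/-- The bilinear extension of `leftTriv` to all pairs of matrices: `(A, X) ↦ adj(A) X` in each
factor. -/
def adjMul : Amb →ₗ[ℝ] Amb →ₗ[ℝ] Amb :=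
  LinearMap.mk₂ ℝ (fun A X => (A.1.adjugate * X.1, A.2.adjugate * X.2))
    (fun A B X => by ext1 <;> simp [adjugate_add_fin_two, add_mul])
    (fun c A X => by ext1 <;> simp [adjugate_smul_fin_two])
    (fun A X Y => by ext1 <;> simp [mul_add])
    (fun c A X => by ext1 <;> simp)

theorem adjMul_incl (p : SLSL) (X : Amb) : adjMul (incl p) X = leftTriv p X := by
  simp [adjMul, incl, leftTriv, leftMul, Matrix.SpecialLinearGroup.coe_inv]

/-- The first-order variation of `leftTriv` in its base point: for `X = p u` tangent at `p`, the
adjugate turns into a sign because `u` is trace-free. -/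
theorem adjMul_tangent (p : SLSL) {X : Amb} (hX : X ∈ tangentAt p) (Y : Amb) :
    adjMul X Y = -((leftTriv p X).1 * (leftTriv p Y).1, (leftTriv p X).2 * (leftTriv p Y).2) := by
  have key : ∀ (a : Matrix.SpecialLinearGroup (Fin 2) ℝ) (x y : Mat), x.trace = 0 →
      ((a : Mat) * x).adjugate * ((a : Mat) * y) = -(x * y) := by
    intro a x y hx
    have h : (x.adjugate * (a : Mat).adjugate) * ((a : Mat) * y) = x.adjugate * y := by
      rw [mul_assoc, ← mul_assoc (a : Mat).adjugate, Matrix.adjugate_mul, a.det_coe, one_smul,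
        one_mul]
    rw [Matrix.adjugate_mul_distrib, h, ← neg_mul]
    congr 1
    rw [Matrix.trace_fin_two] at hx
    ext i j
    fin_cases i <;> fin_cases j <;> simp [Matrix.adjugate_fin_two] <;> linarith
  conv_lhs => rw [← leftMul_leftTriv p X, ← leftMul_leftTriv p Y]
  ext1
  · exact key _ _ _ hX.1
  · exact key _ _ _ hX.2

/-- `gamma` as a bilinear map. -/
noncomputable def lieGamma : Amb →ₗ[ℝ] Amb →ₗ[ℝ] Amb :=
  LinearMap.mk₂ ℝ gamma
    (fun u v w => by
      ext1 <;> simp only [gamma, bracket, Prod.fst_add, Prod.snd_add, Prod.smul_fst, Prod.smul_snd,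
        add_mul, mul_add] <;> module)
    (fun c u v => by
      ext1 <;> simp only [gamma, bracket, Prod.fst_add, Prod.snd_add, Prod.smul_fst, Prod.smul_snd,
        smul_mul_assoc, mul_smul_comm] <;> module)
    (fun u v w => by
      ext1 <;> simp only [gamma, bracket, Prod.fst_add, Prod.snd_add, Prod.smul_fst, Prod.smul_snd,
        add_mul, mul_add] <;> module)
    (fun c u v => by
      ext1 <;> simp only [gamma, bracket, Prod.fst_add, Prod.snd_add, Prod.smul_fst, Prod.smul_snd,
        smul_mul_assoc, mul_smul_comm] <;> module)

theorem gamma_trace (u v : Amb) : (gamma u v).1.trace = 0 ∧ (gamma u v).2.trace = 0 := by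
  constructor <;>
    simp [gamma, bracket, Matrix.trace_mul_comm v.1, Matrix.trace_mul_comm v.2]

end LeftTriv

section Geometry

variable {M : Type*} [TopologicalSpace M] [ChartedSpace (EuclideanSpace ℝ (Fin 3)) M]
  [IsManifold (𝓡 3) ∞ M] {f : M → SLSL} {U : Set M} {q : M}

/-- The vector field `df(Y)` along `f`, in the left trivialisation. -/
noncomputable def trivField (f : M → SLSL) (Y : (q : M) → TangentSpace (𝓡 3) q) (x : M) : Amb :=
  leftTriv (f x) (dmap f x (Y x))

omit [IsManifold (𝓡 3) ∞ M] in
/-- `df` takes values in the tangent spaces, because `J df` does. -/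
theorem IsLagrangianImmersion.dmap_mem (hf : IsLagrangianImmersion f)
    (v : TangentSpace (𝓡 3) q) : dmap f q v ∈ tangentAt (f q) := by
  obtain ⟨h1, h2⟩ := (hf.tangent_to_normal q v).1
  rw [leftTriv_almostCpx] at h1 h2
  have h3 : (1 / √3 : ℝ) ≠ 0 := by positivity
  simp only [lieJ, LinearMap.coe_mk, AddHom.coe_mk, Prod.smul_fst, Prod.smul_snd,
    Matrix.trace_smul, Matrix.trace_sub, smul_eq_mul] at h1 h2
  have k1 := (mul_eq_zero.1 h1).resolve_left h3
  have k2 := (mul_eq_zero.1 h2).resolve_left h3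
  constructor <;> linarith

theorem dmap_smooth (hf : IsLagrangianImmersion f) (hU : IsOpen U)
    {Y : (q : M) → TangentSpace (𝓡 3) q} (hY : SmoothFieldOn Y U) :
    AmbSmoothOn (fun x => dmap f x (Y x)) U := by
  have := contMDiffOn_dirDeriv_field hU hf.smooth.contMDiffOn hY
  simp only [← toEuc_ambDeriv] at this
  exact this

theorem trivField_smooth (hf : IsLagrangianImmersion f) (hU : IsOpen U)
    {Y : (q : M) → TangentSpace (𝓡 3) q} (hY : SmoothFieldOn Y U) :
    AmbSmoothOn (trivField f Y) U := by
  have h1 : AmbSmoothOn (fun x => incl (f x)) U := hf.smooth.contMDiffOn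
  have := h1.bilin (dmap_smooth hf hU hY) (adjMul.compr₂ toEuc.toLinearMap)
  simp only [LinearMap.compr₂_apply, adjMul_incl] at this
  exact this

theorem ambDeriv_trivField (hf : IsLagrangianImmersion f) (hU : IsOpen U) (hq : q ∈ U)
    {Y : (q : M) → TangentSpace (𝓡 3) q} (hY : SmoothFieldOn Y U) (v : TangentSpace (𝓡 3) q) :
    ambDeriv (trivField f Y) q v = adjMul (dmap f q v) (dmap f q (Y q)) +
      leftTriv (f q) (ambDeriv (fun x => dmap f x (Y x)) q v) := by
  have h1 : AmbSmoothOn (fun x => incl (f x)) U := hf.smooth.contMDiffOn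
  have := h1.ambDeriv_bilin (dmap_smooth hf hU hY) hU hq adjMul v
  simp only [adjMul_incl] at this
  exact this

/-- The Maurer-Cartan equation: in the left trivialisation the connection is torsion-free. -/
theorem trivField_torsion (hf : IsLagrangianImmersion f) (hU : IsOpen U) (hq : q ∈ U)
    {X Y : (q : M) → TangentSpace (𝓡 3) q} (hX : SmoothFieldOn X U) (hY : SmoothFieldOn Y U) :
    ∃ Z : TangentSpace (𝓡 3) q,
      (ambDeriv (trivField f Y) q (X q) - ambDeriv (trivField f X) q (Y q) +
        bracket (trivField f X q) (trivField f Y q) = leftTriv (f q) (dmap f q Z)) ∧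
      ∀ G : M → ℝ, ContMDiffOn (𝓡 3) 𝓘(ℝ, ℝ) ∞ G U →
        dirDeriv G q Z = dirDeriv (fun x => dirDeriv G x (Y x)) q (X q) -
          dirDeriv (fun x => dirDeriv G x (X x)) q (Y q) := by
  obtain ⟨Z, hZ⟩ := exists_bracket hU hq hX hY
  refine ⟨Z, ?_, hZ ℝ⟩
  have h := hZ Euc (fun x => toEuc (incl (f x))) hf.smooth.contMDiffOn
  simp only [← toEuc_ambDeriv, ← map_sub] at h
  have h' := toEuc.injective h
  change dmap f q Z = ambDeriv (fun x => dmap f x (Y x)) q (X q) -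
    ambDeriv (fun x => dmap f x (X x)) q (Y q) at h'
  rw [ambDeriv_trivField hf hU hq hX, ambDeriv_trivField hf hU hq hY, h', sub_eq_add_neg _
    (ambDeriv (fun x => dmap f x (X x)) q (Y q)), leftTriv_add, ← neg_one_smul ℝ (ambDeriv
    (fun x => dmap f x (X x)) q (Y q)), leftTriv_smul, neg_one_smul,
    adjMul_tangent _ (hf.dmap_mem _), adjMul_tangent _ (hf.dmap_mem _)]
  ext1 <;> simp only [bracket, trivField, Prod.fst_add, Prod.snd_add, Prod.fst_sub, Prod.snd_sub,
    Prod.fst_neg, Prod.snd_neg] <;> abel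

variable {E : Fin 3 → (q : M) → TangentSpace (𝓡 3) q} {θ : Fin 3 → M → ℝ}

omit [IsManifold (𝓡 3) ∞ M] in
theorem leftTriv_dmap_sum (t : Fin 3 → ℝ) :
    leftTriv (f q) (dmap f q (∑ k, t k • E k q)) = ∑ k, t k • trivField f (E k) q := by
  rw [← adjMul_incl]
  simp only [map_sum, map_smul, adjMul_incl]
  rfl

theorem IsDiagonalizingFrame.lieMetric_eq (H : IsDiagonalizingFrame f U E θ) (hq : q ∈ U)
    (i j : Fin 3) : lieMetric (trivField f (E i) q) (trivField f (E j) q) = delta1 i j := by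
  rw [← H.orthonormal q hq i j, nkMetric_eq]
  rfl

omit [IsManifold (𝓡 3) ∞ M] in
theorem IsLagrangianImmersion.lieMetric_lieJ_dmap (hf : IsLagrangianImmersion f)
    (v w : TangentSpace (𝓡 3) q) :
    lieMetric (leftTriv (f q) (dmap f q v)) (lieJ (leftTriv (f q) (dmap f q w))) = 0 := by
  rw [← (hf.tangent_to_normal q w).2 v, nkMetric_eq, leftTriv_almostCpx]

omit [IsManifold (𝓡 3) ∞ M] in
theorem IsLagrangianImmersion.lieMetric_lieJ_eq (hf : IsLagrangianImmersion f)
    (X Y : (q : M) → TangentSpace (𝓡 3) q) :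
    lieMetric (trivField f X q) (lieJ (trivField f Y q)) = 0 :=
  hf.lieMetric_lieJ_dmap (X q) (Y q)

theorem IsDiagonalizingFrame.lieP_eq (H : IsDiagonalizingFrame f U E θ) (hq : q ∈ U)
    (i : Fin 3) : lieP (trivField f (E i) q) =
      Real.cos (2 * θ i q) • trivField f (E i) q +
        Real.sin (2 * θ i q) • lieJ (trivField f (E i) q) := by
  obtain ⟨A, B, h1, h2⟩ := H.diagonal q hq
  have h := h1 (E i q)
  rw [(h2 i).1, (h2 i).2] at h
  have h3 := congrArg (leftTriv (f q)) h
  rw [leftTriv_almostProd, leftTriv_add, leftTriv_almostCpx, map_smul, map_smul, leftTriv_smul,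
    leftTriv_smul, map_smul] at h3
  exact h3

theorem IsDiagonalizingFrame.exists_sum_eq (H : IsDiagonalizingFrame f U E θ) (hq : q ∈ U)
    (v : TangentSpace (𝓡 3) q) : ∃ t : Fin 3 → ℝ, v = ∑ k, t k • E k q := by
  have hli : LinearIndependent ℝ (fun k => E k q) := by
    rw [Fintype.linearIndependent_iff]
    intro g hg i
    let L : TangentSpace (𝓡 3) q →ₗ[ℝ] Amb := adjMul (incl (f q)) ∘ₗ dmap f q
    have hL : ∀ k, L (E k q) = trivField f (E k) q := fun k => adjMul_incl _ _
    have h := congrArg (fun w => lieMetric (L w) (trivField f (E i) q)) hg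
    simp only [map_sum, map_smul, map_zero, hL, LinearMap.sum_apply, LinearMap.smul_apply,
      H.lieMetric_eq hq, smul_eq_mul, LinearMap.zero_apply] at h
    rw [Finset.sum_eq_single i (fun b _ hb => by rw [delta1_ne _ _ hb, mul_zero]) (by simp)] at h
    exact (mul_eq_zero.1 h).resolve_right (delta1_self_ne_zero i)
  have hcard : Fintype.card (Fin 3) = Module.finrank ℝ (TangentSpace (𝓡 3) q) := by
    have : Module.finrank ℝ (EuclideanSpace ℝ (Fin 3)) = Fintype.card (Fin 3) :=
      finrank_euclideanSpace
    exact this.symm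
  let b := basisOfLinearIndependentOfCardEqFinrank hli hcard
  refine ⟨b.repr v, ?_⟩
  have := (b.sum_repr v).symm
  simpa [b] using this

/-- The functions `cos 2θᵢ` and `sin 2θᵢ` are smooth, although the angles need not be. -/
theorem IsDiagonalizingFrame.cos_sin_smooth (H : IsDiagonalizingFrame f U E θ)
    (hf : IsLagrangianImmersion f) (hU : IsOpen U) (i : Fin 3) :
    ContMDiffOn (𝓡 3) 𝓘(ℝ, ℝ) ∞ (fun x => Real.cos (2 * θ i x)) U ∧
      ContMDiffOn (𝓡 3) 𝓘(ℝ, ℝ) ∞ (fun x => Real.sin (2 * θ i x)) U := by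
  have hδ := delta1_self_ne_zero i
  have hs := trivField_smooth hf hU (H.smooth i)
  constructor
  · refine (hs.bilin hs ((delta1 i i)⁻¹ • lieMetric.compl₁₂ lieP LinearMap.id)).congr
      fun x hx => ?_
    simp only [LinearMap.smul_apply, LinearMap.compl₁₂_apply, LinearMap.id_apply, H.lieP_eq hx,
      map_add, map_smul, LinearMap.add_apply, H.lieMetric_eq hx, smul_eq_mul, lieMetric_lieJ_left,
      hf.lieMetric_lieJ_eq]
    field_simp
    ring
  · refine (hs.bilin hs ((delta1 i i)⁻¹ • lieMetric.compl₁₂ lieP lieJ)).congr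
      fun x hx => ?_
    simp only [LinearMap.smul_apply, LinearMap.compl₁₂_apply, H.lieP_eq hx,
      map_add, map_smul, LinearMap.add_apply, H.lieMetric_eq hx, smul_eq_mul, lieMetric_lieJ_lieJ,
      hf.lieMetric_lieJ_eq]
    field_simp
    ring

/-- A diagonalizing frame of a Lagrangian immersion gives at each point the pointwise data
`FrameJet`, with `t i j` the coefficients of the bracket of the `i`-th and `j`-th frame field. -/
theorem IsDiagonalizingFrame.exists_frameJet (H : IsDiagonalizingFrame f U E θ)
    (hf : IsLagrangianImmersion f) (hU : IsOpen U) (hq : q ∈ U) :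
    ∃ t : Fin 3 → Fin 3 → Fin 3 → ℝ,
      FrameJet (fun i => trivField f (E i) q) (fun i j => ambDeriv (trivField f (E j)) q (E i q))
        (fun i => θ i q) (fun i j => dirDeriv (fun x => Real.cos (2 * θ j x)) q (E i q))
        (fun i j => dirDeriv (fun x => Real.sin (2 * θ j x)) q (E i q)) t ∧
      ∀ i j, ∀ G : M → ℝ, ContMDiffOn (𝓡 3) 𝓘(ℝ, ℝ) ∞ G U →
        ∑ k, t i j k * dirDeriv G q (E k q) =
          dirDeriv (fun x => dirDeriv G x (E j x)) q (E i q) -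
          dirDeriv (fun x => dirDeriv G x (E i x)) q (E j q) := by
  choose Z hZ1 hZ2 using fun i j => trivField_torsion hf hU hq (H.smooth i) (H.smooth j)
  choose t ht using fun i j => H.exists_sum_eq hq (Z i j)
  have hs : ∀ i, AmbSmoothOn (trivField f (E i)) U := fun i => trivField_smooth hf hU (H.smooth i)
  refine ⟨t, ⟨fun i => (hf.dmap_mem (E i q)).1, fun i => (hf.dmap_mem (E i q)).2,
    H.lieMetric_eq hq, fun i j => hf.lieMetric_lieJ_eq (E i) (E j), H.lieP_eq hq,
    ?_, ?_, ?_⟩, ?_⟩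
  · intro k i j
    have := (hs i).dirDeriv_bilin (hs j) hU hq (lieMetric.compl₂ lieJ) (E k q)
    simp only [LinearMap.compl₂_apply] at this
    rw [← this, dirDeriv_congr hU hq (fun x hx => hf.lieMetric_lieJ_eq (E i) (E j)), dirDeriv_const]
  · intro k i
    have hJ : AmbSmoothOn (fun x => lieJ (trivField f (E i) x)) U :=
      (hs i).linear (toEuc.toLinearMap ∘ₗ lieJ)
    obtain ⟨hc, hn⟩ := H.cos_sin_smooth hf hU i
    rw [← (hs i).ambDeriv_linear hU hq lieP, ← (hs i).ambDeriv_linear hU hq lieJ,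
      ← AmbSmoothOn.ambDeriv_smul hc (hs i) hU hq, ← AmbSmoothOn.ambDeriv_smul hn hJ hU hq,
      ← AmbSmoothOn.ambDeriv_add (AmbSmoothOn.smul hc (hs i)) (AmbSmoothOn.smul hn hJ) hU hq]
    exact ambDeriv_congr hU hq (fun x hx => H.lieP_eq hx i) _
  · intro i j
    rw [hZ1, ht i j, leftTriv_dmap_sum]
  · intro i j G hG
    rw [← hZ2 i j G hG]
    conv_rhs => rw [ht i j]
    simp only [map_sum, map_smul, smul_eq_mul]

end Geometry

/-! ### Vanishing of the second fundamental form -/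

section Conclusion

variable {M : Type*} [TopologicalSpace M] [ChartedSpace (EuclideanSpace ℝ (Fin 3)) M]
  [IsManifold (𝓡 3) ∞ M] {f : M → SLSL} {U : Set M} {q : M}
  {E : Fin 3 → (q : M) → TangentSpace (𝓡 3) q} {θ : Fin 3 → M → ℝ}

theorem cos_sin_two_mul_eq_of_modEq {x y : ℝ} (h : x ≡ y [PMOD Real.pi]) :
    Real.cos (2 * y) = Real.cos (2 * x) ∧ Real.sin (2 * y) = Real.sin (2 * x) := by
  obtain ⟨z, hz⟩ := AddCommGroup.modEq_iff_eq_add_zsmul.1 h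
  have : 2 * y = 2 * x + z * (2 * Real.pi) := by
    rw [hz, zsmul_eq_mul]; ring
  rw [this, Real.cos_add_int_mul_two_pi, Real.sin_add_int_mul_two_pi]
  exact ⟨rfl, rfl⟩

/-- All components of the second fundamental form vanish where two angle functions agree
modulo `π`. -/
theorem IsDiagonalizingFrame.sff_eq_zero (H : IsDiagonalizingFrame f U E θ)
    (hf : IsLagrangianImmersion f) (hU : IsOpen U) {a b : Fin 3} (hab : a ≠ b)
    (hmod : ∀ x ∈ U, θ a x ≡ θ b x [PMOD Real.pi]) (hq : q ∈ U) (i j k : Fin 3) :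
    FrameJet.sff (fun i => trivField f (E i) q)
      (fun i j => ambDeriv (trivField f (E j)) q (E i q)) i j k = 0 := by
  obtain ⟨r, har, hbr⟩ : ∃ r : Fin 3, a ≠ r ∧ b ≠ r := by
    have h : ∀ a b : Fin 3, a ≠ b → ∃ r : Fin 3, a ≠ r ∧ b ≠ r := by decide
    exact h a b hab
  have hcb : ∀ x ∈ U, Real.cos (2 * θ b x) = Real.cos (2 * θ a x) := fun x hx =>
    (cos_sin_two_mul_eq_of_modEq (hmod x hx)).1
  have hsb : ∀ x ∈ U, Real.sin (2 * θ b x) = Real.sin (2 * θ a x) := fun x hx =>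
    (cos_sin_two_mul_eq_of_modEq (hmod x hx)).2
  -- The angle functions only matter modulo `π`, so the two angles may be taken equal at each point.
  let θ' : M → Fin 3 → ℝ := fun x i => if i = b then θ a x else θ i x
  have hθa : ∀ x, θ' x a = θ a x := fun x => if_neg hab
  have hθb : ∀ x, θ' x b = θ' x a := fun x => by rw [hθa]; exact if_pos rfl
  have hθr : ∀ x, θ' x r = θ r x := fun x => if_neg hbr.symm
  have jet : ∀ x ∈ U, ∃ t : Fin 3 → Fin 3 → Fin 3 → ℝ,
      FrameJet (fun i => trivField f (E i) x) (fun i j => ambDeriv (trivField f (E j)) x (E i x))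
        (θ' x) (fun i j => dirDeriv (fun x => Real.cos (2 * θ j x)) x (E i x))
        (fun i j => dirDeriv (fun x => Real.sin (2 * θ j x)) x (E i x)) t ∧
      ∀ i j, ∀ G : M → ℝ, ContMDiffOn (𝓡 3) 𝓘(ℝ, ℝ) ∞ G U →
        ∑ k, t i j k * dirDeriv G x (E k x) =
          dirDeriv (fun x => dirDeriv G x (E j x)) x (E i x) -
          dirDeriv (fun x => dirDeriv G x (E i x)) x (E j x) := by
    intro x hx
    obtain ⟨t, h1, h2⟩ := H.exists_frameJet hf hU hx
    refine ⟨t, h1.congr_angle (fun i => ?_) (fun i => ?_), h2⟩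
    · by_cases hi : i = b
      · simp only [θ', hi, if_true, hcb x hx]
      · simp only [θ', hi, if_false]
    · by_cases hi : i = b
      · simp only [θ', hi, if_true, hsb x hx]
      · simp only [θ', hi, if_false]
  have hcr : ∀ x ∈ U, Real.cos (2 * θ r x) =
      2 * (Real.cos (2 * θ a x) * Real.cos (2 * θ a x)) + -1 := by
    intro x hx
    obtain ⟨t, h1, -⟩ := jet x hx
    have := (h1.third_angle hab har hbr (hθb x)).1
    rw [hθa, hθr] at this
    rw [this]; ring
  have hsr : ∀ x ∈ U, Real.sin (2 * θ r x) =
      -2 * (Real.sin (2 * θ a x) * Real.cos (2 * θ a x)) := by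
    intro x hx
    obtain ⟨t, h1, -⟩ := jet x hx
    have := (h1.third_angle hab har hbr (hθb x)).2
    rw [hθa, hθr] at this
    rw [this]; ring
  obtain ⟨sc, ss⟩ := H.cos_sin_smooth hf hU a
  have dcb : ∀ x ∈ U, ∀ v, dirDeriv (fun x => Real.cos (2 * θ b x)) x v =
      dirDeriv (fun x => Real.cos (2 * θ a x)) x v := fun x hx => dirDeriv_congr hU hx hcb
  have dsb : ∀ x ∈ U, ∀ v, dirDeriv (fun x => Real.sin (2 * θ b x)) x v =
      dirDeriv (fun x => Real.sin (2 * θ a x)) x v := fun x hx => dirDeriv_congr hU hx hsb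
  have const_mul : ∀ (c : ℝ) {G : M → ℝ}, ContMDiffOn (𝓡 3) 𝓘(ℝ, ℝ) ∞ G U →
      ContMDiffOn (𝓡 3) 𝓘(ℝ, ℝ) ∞ (fun x => c * G x) U ∧
      ∀ v, dirDeriv (fun x => c * G x) q v = c * dirDeriv G q v := fun c G hG =>
    ⟨contMDiffOn_const.mul hG, fun v => by
      rw [dirDeriv_mul hU hq contMDiffOn_const hG, dirDeriv_const, zero_mul, zero_add]⟩
  have scc : ContMDiffOn (𝓡 3) 𝓘(ℝ, ℝ) ∞
      (fun x => Real.cos (2 * θ a x) * Real.cos (2 * θ a x)) U := sc.mul sc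
  have ssc : ContMDiffOn (𝓡 3) 𝓘(ℝ, ℝ) ∞
      (fun x => Real.sin (2 * θ a x) * Real.cos (2 * θ a x)) U := ss.mul sc
  have dcr : ∀ v, dirDeriv (fun x => Real.cos (2 * θ r x)) q v =
      4 * Real.cos (2 * θ a q) * dirDeriv (fun x => Real.cos (2 * θ a x)) q v := by
    intro v
    rw [dirDeriv_congr hU hq hcr,
      dirDeriv_add hU hq (const_mul 2 scc).1 contMDiffOn_const, dirDeriv_const,
      (const_mul 2 scc).2, dirDeriv_mul hU hq sc sc]
    ring
  have dsr : ∀ v, dirDeriv (fun x => Real.sin (2 * θ r x)) q v =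
      -2 * (dirDeriv (fun x => Real.sin (2 * θ a x)) q v * Real.cos (2 * θ a q) +
        Real.sin (2 * θ a q) * dirDeriv (fun x => Real.cos (2 * θ a x)) q v) := by
    intro v
    rw [dirDeriv_congr hU hq hsr, (const_mul (-2) ssc).2, dirDeriv_mul hU hq ss sc]
  have zero : ∀ x ∈ U,
      (dirDeriv (fun x => Real.cos (2 * θ a x)) x (E a x) = 0 ∧
        dirDeriv (fun x => Real.sin (2 * θ a x)) x (E a x) = 0) ∧
      dirDeriv (fun x => Real.cos (2 * θ a x)) x (E b x) = 0 ∧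
        dirDeriv (fun x => Real.sin (2 * θ a x)) x (E b x) = 0 := by
    intro x hx
    obtain ⟨t, h1, -⟩ := jet x hx
    exact (h1.deriv_eq_zero hab (hθb x) (fun j => dcb x hx _) (fun j => dsb x hx _)).2
  obtain ⟨t, h1, h2⟩ := jet q hq
  refine h1.sff_eq_zero hab har hbr (hθb q) (fun j => dcb q hq _) (fun j => dsb q hq _)
    (fun j => ?_) (fun j => ?_) ?_ ?_ i j k
  · rw [hθa]; exact dcr _
  · rw [hθa]; exact dsr _
  · rw [h2 a b _ sc, dirDeriv_congr hU hq (fun x hx => (zero x hx).2.1),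
      dirDeriv_congr hU hq (fun x hx => (zero x hx).1.1), dirDeriv_const, dirDeriv_const, sub_zero]
  · rw [h2 a b _ ss, dirDeriv_congr hU hq (fun x hx => (zero x hx).2.2),
      dirDeriv_congr hU hq (fun x hx => (zero x hx).1.2), dirDeriv_const, dirDeriv_const, sub_zero]

/-- A tangent vector of `SL(2,ℝ) × SL(2,ℝ)` orthogonal to the normal vectors `J Eₖ` is tangent
to `M`. -/
theorem IsDiagonalizingFrame.exists_eq_dmap (H : IsDiagonalizingFrame f U E θ)
    (hf : IsLagrangianImmersion f) (hq : q ∈ U) {η : Amb} (h1 : η.1.trace = 0)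
    (h2 : η.2.trace = 0) (hη : ∀ k, lieMetric η (lieJ (trivField f (E k) q)) = 0) :
    ∃ z : TangentSpace (𝓡 3) q, η = leftTriv (f q) (dmap f q z) := by
  have hspan : ∀ v : TangentSpace (𝓡 3) q, ∃ w : Fin 3 → ℝ,
      leftTriv (f q) (dmap f q v) = ∑ k, w k • trivField f (E k) q := by
    intro v
    obtain ⟨w, hw⟩ := H.exists_sum_eq hq v
    exact ⟨w, by rw [hw, leftTriv_dmap_sum]⟩
  -- Subtract the tangential part of `η`; what remains is normal, so `J` maps it to a tangent vector,
  -- and this one is orthogonal to the frame, hence zero.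
  set z : TangentSpace (𝓡 3) q :=
    ∑ k, (delta1 k k * lieMetric η (trivField f (E k) q)) • E k q with hz
  have hz' : leftTriv (f q) (dmap f q z) =
      ∑ k, (delta1 k k * lieMetric η (trivField f (E k) q)) • trivField f (E k) q := by
    rw [hz, leftTriv_dmap_sum]
  have hδ : ∀ k, delta1 k k * delta1 k k = 1 := by
    intro k
    rw [delta1, Matrix.diagonal_apply_eq]
    fin_cases k <;> simp
  set ζ := η - leftTriv (f q) (dmap f q z) with hζ
  have horth : ∀ k, lieMetric ζ (trivField f (E k) q) = 0 := by
    intro k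
    rw [hζ, hz', map_sub, LinearMap.sub_apply, map_sum, LinearMap.sum_apply,
      Finset.sum_eq_single k]
    · rw [map_smul, LinearMap.smul_apply, H.lieMetric_eq hq, smul_eq_mul]
      linear_combination (-lieMetric η (trivField f (E k) q)) * hδ k
    · intro l _ hl
      rw [map_smul, LinearMap.smul_apply, H.lieMetric_eq hq, delta1_ne _ _ hl, smul_zero]
    · simp
  have hJ : ∀ k, lieMetric ζ (lieJ (trivField f (E k) q)) = 0 := by
    intro k
    rw [hζ, map_sub, LinearMap.sub_apply, hη, zero_sub, neg_eq_zero]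
    exact hf.lieMetric_lieJ_dmap z (E k q)
  obtain ⟨t1, t2⟩ := hf.dmap_mem z
  have hnormal : IsNormalVector f q (leftMul (f q) ζ) := by
    refine ⟨?_, fun v => ?_⟩
    · rw [tangentAt, Set.mem_ofPred_eq, leftTriv_leftMul, hζ]
      simp [h1, h2, t1, t2]
    · obtain ⟨w, hw⟩ := hspan v
      rw [nkMetric_eq, leftTriv_leftMul, hw, lieMetric_symm]
      simp [horth]
  obtain ⟨v, hv⟩ := hf.normal_to_tangent q _ hnormal
  have hv' : lieJ ζ = leftTriv (f q) (dmap f q v) := by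
    rw [← hv, leftTriv_almostCpx, leftTriv_leftMul]
  have hv0 : v = 0 := by
    refine hf.nondegenerate q v fun w => ?_
    obtain ⟨c, hc⟩ := hspan w
    rw [nkMetric_eq, ← hv', hc]
    simp [lieMetric_lieJ_left, hJ]
  have hζ0 : ζ = 0 := by
    rw [← neg_eq_zero, ← lieJ_lieJ, hv', hv0, map_zero, ← adjMul_incl, map_zero, map_zero]
  exact ⟨z, sub_eq_zero.1 hζ0⟩

theorem trivField_trace (hf : IsLagrangianImmersion f) (hU : IsOpen U) (hq : q ∈ U)
    {Y : (q : M) → TangentSpace (𝓡 3) q} (hY : SmoothFieldOn Y U) (v : TangentSpace (𝓡 3) q) :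
    (ambDeriv (trivField f Y) q v).1.trace = 0 ∧ (ambDeriv (trivField f Y) q v).2.trace = 0 := by
  have hs := trivField_smooth hf hU hY
  constructor
  · have h := hs.dirDeriv_linear hU hq
      (Matrix.traceLinearMap (Fin 2) ℝ ℝ ∘ₗ LinearMap.fst ℝ Mat Mat) v
    refine h.symm.trans (Eq.trans ?_ (dirDeriv_const (0 : ℝ) v))
    exact dirDeriv_congr hU hq (fun x _ => (hf.dmap_mem (Y x)).1) v
  · have h := hs.dirDeriv_linear hU hq
      (Matrix.traceLinearMap (Fin 2) ℝ ℝ ∘ₗ LinearMap.snd ℝ Mat Mat) v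
    refine h.symm.trans (Eq.trans ?_ (dirDeriv_const (0 : ℝ) v))
    exact dirDeriv_congr hU hq (fun x _ => (hf.dmap_mem (Y x)).2) v

/-- The second fundamental form is a tensor: if it vanishes on a frame, it vanishes on all
fields. -/
theorem IsDiagonalizingFrame.lieMetric_covDeriv_eq_zero (H : IsDiagonalizingFrame f U E θ)
    (hf : IsLagrangianImmersion f) (hU : IsOpen U) (hq : q ∈ U)
    (hsff : ∀ i j k, FrameJet.sff (fun i => trivField f (E i) q)
      (fun i j => ambDeriv (trivField f (E j)) q (E i q)) i j k = 0)
    {V : Set M} (hV : IsOpen V) (hqV : q ∈ V) {X Y : (q : M) → TangentSpace (𝓡 3) q}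
    (hY : SmoothFieldOn Y V) (k : Fin 3) :
    lieMetric (ambDeriv (trivField f Y) q (X q) + gamma (trivField f X q) (trivField f Y q))
      (lieJ (trivField f (E k) q)) = 0 := by
  obtain ⟨t, hjet, -⟩ := H.exists_frameJet hf hU hq
  have hW : IsOpen (U ∩ V) := hU.inter hV
  have hqW : q ∈ U ∩ V := ⟨hq, hqV⟩
  have hYs : AmbSmoothOn (trivField f Y) (U ∩ V) :=
    trivField_smooth hf hW (hY.mono Set.inter_subset_right)
  have hEs : ∀ i, AmbSmoothOn (trivField f (E i)) (U ∩ V) := fun i =>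
    trivField_smooth hf hW ((H.smooth i).mono Set.inter_subset_left)
  obtain ⟨x, hx⟩ := H.exists_sum_eq hq (X q)
  obtain ⟨y, hy⟩ := H.exists_sum_eq hq (Y q)
  have hXe : trivField f X q = ∑ i, x i • trivField f (E i) q := by
    rw [trivField, hx, leftTriv_dmap_sum]
  have hYe : trivField f Y q = ∑ i, y i • trivField f (E i) q := by
    rw [trivField, hy, leftTriv_dmap_sum]
  have hD : ∀ i, lieMetric (ambDeriv (trivField f Y) q (E i q)) (lieJ (trivField f (E k) q)) =
      ∑ j, y j * lieMetric (ambDeriv (trivField f (E j)) q (E i q))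
        (lieJ (trivField f (E k) q)) := by
    intro i
    have h := hYs.dirDeriv_bilin (hEs k) hW hqW (lieMetric.compl₂ lieJ) (E i q)
    simp only [LinearMap.compl₂_apply] at h
    rw [dirDeriv_congr hW hqW (fun x _ => hf.lieMetric_lieJ_eq Y (E k)), dirDeriv_const] at h
    rw [eq_neg_of_add_eq_zero_left h.symm, hYe, map_sum, LinearMap.sum_apply,
      ← Finset.sum_neg_distrib]
    refine Finset.sum_congr rfl fun j _ => ?_
    have h3 := hjet.deriv_lagr i j k
    rw [map_smul, LinearMap.smul_apply, smul_eq_mul]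
    linear_combination (-y j) * h3
  have hG : gamma (trivField f X q) (trivField f Y q) = ∑ i, ∑ j, (x i * y j) •
      gamma (trivField f (E i) q) (trivField f (E j) q) := by
    change lieGamma _ _ = ∑ i, ∑ j, _ • lieGamma _ _
    rw [hXe, hYe]
    simp only [map_sum, LinearMap.sum_apply, map_smul, LinearMap.smul_apply, Finset.smul_sum,
      smul_smul]
    rw [Finset.sum_comm]
    simp only [mul_comm]
  rw [map_add, LinearMap.add_apply, hG, hx]
  simp only [map_sum, map_smul, LinearMap.sum_apply, LinearMap.smul_apply, hD, smul_eq_mul]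
  rw [← Finset.sum_add_distrib]
  refine Finset.sum_eq_zero fun i _ => ?_
  rw [Finset.mul_sum, ← Finset.sum_add_distrib]
  refine Finset.sum_eq_zero fun j _ => ?_
  have h := hsff i j k
  rw [FrameJet.sff, map_add, LinearMap.add_apply] at h
  linear_combination (x i * y j) * h

end Conclusion

end NKSL2

theorem proposition4p3 {M : Type*} [TopologicalSpace M]
    [ChartedSpace (EuclideanSpace ℝ (Fin 3)) M] [IsManifold (𝓡 3) ∞ M]
    (f : M → SLSL) (hf : IsLagrangianImmersion f)
    (hdiag : ∀ p : M, ∃ U : Set M, IsOpen U ∧ p ∈ U ∧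
      ∃ (E : Fin 3 → (q : M) → TangentSpace (𝓡 3) q) (θ : Fin 3 → M → ℝ),
        IsDiagonalizingFrame f U E θ ∧
        ∃ i j : Fin 3, i ≠ j ∧ ∀ q ∈ U, θ i q ≡ θ j q [PMOD Real.pi]) :
    IsTotallyGeodesic f := by
  intro V hV X Y _ hY q hqV
  obtain ⟨U, hU, hq, E, θ, H, a, b, hab, hmod⟩ := hdiag q
  have hsff := H.sff_eq_zero hf hU hab hmod hq
  have hk := fun k => H.lieMetric_covDeriv_eq_zero (X := X) hf hU hq hsff hV hqV hY k
  have ht := trivField_trace hf hV hqV hY (X q)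
  have hg := gamma_trace (trivField f X q) (trivField f Y q)
  obtain ⟨z, hz⟩ := H.exists_eq_dmap hf hq
    (by rw [Prod.fst_add, Matrix.trace_add, ht.1, hg.1, add_zero])
    (by rw [Prod.snd_add, Matrix.trace_add, ht.2, hg.2, add_zero]) hk
  refine ⟨⟨?_, fun v => ?_⟩, z, ?_⟩
  · simp [tangentAt, leftTriv, leftMul]
  · rw [nkMetric_eq, ← adjMul_incl _ 0, map_zero, map_zero]
  · rw [add_zero]
    have h := congrArg (leftMul (f q)) hz
    rw [leftMul_leftTriv] at h
    exact h
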